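/- Let $\mathbb D$ be the open unit disc, $dA=\frac{dx\,dy}{\pi}$, and let $H^2$ be the Hardy space of holomorphic functions $f(z)=\sum_{n\ge0}a_nz^n$ on $\mathbb D$ with $\|f\|_{H^2}^2=\sum_n|a_n|^2<\infty$. Let $\mu$ be a positive Borel measure on $\mathbb D$ with $\int_{\mathbb D}(1-|w|^2)\,d\mu(w)<\infty$, and let $\omega$ be the pure superharmonic weight with Riesz measure $\mu$, that is, the Green potential $$\omega(z)=\int_{\mathbb D}\log\left|\frac{1-\overline w z}{z-w}\right|d\mu(w),\qquad z\in\mathbb D .$$ Let $\mathcal D_\omega$ be the space of all $f\in H^2$ with $\int_{\mathbb D}|f'|^2\omega\,dA<\infty$, with the norm given by $$\|f\|_{\mathcal D_\omega}^2=\|f\|_{H^2}^2+\int_{\mathbb D}|f'(z)|^2\omega(z)\,dA(z).$$ Then $\mathcal D_\omega$ has a reproducing kernel $K^\omega$, and there are universal constants $0<c\le C<\infty$ (independent of $\mu$ and $z$) such that for all $z\in\mathbb D\setminus\{0\}$ $$c\,\Bigl(1+\int_0^{|z|}\frac{dr}{(1-r)V_\mu(rz/|z|)+(1-r)^2}\Bigr)\le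 K^\omega(z,z)\le C\,\Bigl(1+\int_0^{|z|}\frac{dr}{(1-r)V_\mu(rz/|z|)+(1-r)^2}\Bigr),$$ where $$V_\mu(z)=\int_{\mathbb D}\frac{(1-|z|^2)(1-|w|^2)}{|1-z\overline w|^2}\,d\mu(w),\qquad z\in\mathbb D.$$ -/

import Mathlib

open MeasureTheory
open scoped ENNReal ComplexConjugate

namespace SuperharmonicDirichlet

noncomputable section

/-- The open unit disc. -/
def disc : Set ℂ := Metric.ball (0 : ℂ) 1

/-- The normalized area measure `dA = dx dy / π` on the unit disc. -/
def areaMeasure : Measure ℂ := (ENNReal.ofReal Real.pi)⁻¹ • volume.restrict disc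

/-- The Green kernel `log |(1 - conj w * z) / (z - w)|` of the unit disc, with value `+∞` on the
diagonal. It is nonnegative for `z, w` in the disc. -/
def greenKernel (z w : ℂ) : ℝ≥0∞ :=
  open Classical in
  if z = w then ⊤ else ENNReal.ofReal (Real.log ‖(1 - conj w * z) / (z - w)‖)

/-- The Green potential `G_μ` of a positive Borel measure `μ` on the disc. A measure on the disc is
given as a measure on `ℂ` of which only the restriction to the disc is ever used. -/
def greenPotential (μ : Measure ℂ) (z : ℂ) : ℝ≥0∞ :=
  ∫⁻ w in disc, greenKernel z w ∂μ

/-- `ω` is the pure superharmonic weight on the disc with Riesz measure `μ`: it is the Green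
potential of `μ`, where `∫ (1 - |w|²) dμ(w) < ∞`. -/
structure IsPureSuperharmonicWeight (ω : ℂ → ℝ≥0∞) (μ : Measure ℂ) : Prop where
  riesz_finite : ∫⁻ w in disc, ENNReal.ofReal (1 - ‖w‖ ^ 2) ∂μ < ⊤
  eq_green : ∀ z ∈ disc, ω z = greenPotential μ z

/-- The `n`-th Taylor coefficient of `f` at the origin. -/
def taylorCoeff (f : ℂ → ℂ) (n : ℕ) : ℂ := iteratedDeriv n f 0 / (n.factorial : ℂ)

/-- Membership in the Hardy space `H²`: `f` is holomorphic on the disc, with square summable Taylor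
coefficients. Values of `f` outside the disc are irrelevant. -/
def MemHardy (f : ℂ → ℂ) : Prop :=
  DifferentiableOn ℂ f disc ∧ Summable fun n => ‖taylorCoeff f n‖ ^ 2

/-- The inner product of `H²`. -/
def hardyInner (f g : ℂ → ℂ) : ℂ := ∑' n, taylorCoeff f n * conj (taylorCoeff g n)

/-- The weighted Dirichlet integral `∫ |f'|² ω dA`. -/
def dirichletIntegral (ω : ℂ → ℝ≥0∞) (f : ℂ → ℂ) : ℝ≥0∞ :=
  ∫⁻ z, ‖deriv f z‖ₑ ^ 2 * ω z ∂areaMeasure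

/-- Membership in the weighted Dirichlet space `D_ω`. -/
def MemDirichlet (ω : ℂ → ℝ≥0∞) (f : ℂ → ℂ) : Prop :=
  MemHardy f ∧ dirichletIntegral ω f < ⊤

/-- The inner product of `D_ω`, whose norm is `‖f‖² = ‖f‖²_{H²} + ∫ |f'|² ω dA`. -/
def dirichletInner (ω : ℂ → ℝ≥0∞) (f g : ℂ → ℂ) : ℂ :=
  hardyInner f g + ∫ z, deriv f z * conj (deriv g z) * ((ω z).toReal : ℂ) ∂areaMeasure

/-- `K` is the reproducing kernel of `D_ω`: for every `z` in the disc, `K(·, z)` belongs to `D_ω`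
and `f(z) = ⟨f, K(·, z)⟩` for every `f` in `D_ω`. -/
def IsReproducingKernel (ω : ℂ → ℝ≥0∞) (K : ℂ → ℂ → ℂ) : Prop :=
  ∀ z ∈ disc, MemDirichlet ω (fun ζ => K ζ z) ∧
    ∀ f : ℂ → ℂ, MemDirichlet ω f → f z = dirichletInner ω f (fun ζ => K ζ z)

/-- `V_μ(z) = ∫ (1 - |z|²)(1 - |w|²) / |1 - z conj w|² dμ(w)`. -/
def V (μ : Measure ℂ) (z : ℂ) : ℝ :=
  ∫ w in disc, (1 - ‖z‖ ^ 2) * (1 - ‖w‖ ^ 2) / ‖1 - z * conj w‖ ^ 2 ∂μ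

/-- `1 + ∫_0^{|z|} dr / ((1 - r) V_μ(r z / |z|) + (1 - r)²)`. -/
def kernelSize (μ : Measure ℂ) (z : ℂ) : ℝ :=
  1 + ∫ r in (0 : ℝ)..‖z‖, 1 / ((1 - r) * V μ ((r : ℂ) * z / (‖z‖ : ℂ)) + (1 - r) ^ 2)

end

end SuperharmonicDirichlet

namespace SuperharmonicDirichlet

open Set

/-! Write e = z/|z|, ρ = |z|, ψ(r) = (1-r)V_μ(re) + (1-r)² and S = ∫_0^ρ dr/ψ(r); the claim is that
K(z,z) is comparable to 1 + S. Since K(z,z) is the supremum of |f(z)|² over the unit ball of D_ω,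
the upper bound is a pointwise estimate for every f, while the lower bound needs one good test
function.

Upper bound. Cauchy–Schwarz along the radius gives |f(z) - f(0)|² ≤ S ∫ |f'(re)|² ψ(r) dr. Here ψ(r)
≤ (1-r)W(re) with W(z) = 1 - |z|² + V_μ(z), and W(re) ≤ 9W on the disc of radius (1-r)/2 about re.
The area submean property of |f'|² and Tonelli then bound the radial integral by a multiple of ∫
|f'|² W dA (`lintegral_radius_le`). The part 1 - |z|² is paid for by the Hardy norm. The part V_μ is
paid for by the Dirichlet integral, because 1 - t² ≤ 2 log(1/t) yields V_μ ≤ 2ω.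

Lower bound. The test function is f(ζ) = ∫_0^ρ c(x)/(1 - x ē ζ) dx with c = (1-x)/ψ. Its Hardy norm
is the quadratic form of the kernel 1/(1-xy), which is bounded on L² by a Schur test
(`lintegral_lintegral_hilbert_le`). For the Dirichlet integral, Tonelli reduces ω to a single Green
kernel with pole w. The Möbius involution φ_w exchanging 0 and w moves the pole to the origin, where
the integral is half the squared Hardy norm of f∘φ_w minus its constant term. This is again a
superposition of Szegő kernels, so the same Hilbert inequality applies, and integration in w
produces V_μ. The outcome is ‖f‖² ≤ 24 S and |f(z)| ≥ S/2, hence S ≤ 96 K(z,z); the constant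
function 1 gives K(z,z) ≥ 1.

Existence of K. The map f ↦ (Taylor coefficients, f') identifies D_ω isometrically with a closed
subspace of ℓ² ⊕ L²(ω dA), and the kernel is the orthogonal projection of the vector that evaluates
power series at z. -/

/-! ### Parseval's identity on a circle. -/

theorem integral_exp_int_mul_I (k : ℤ) :
    ∫ θ in Ioo (-Real.pi) Real.pi, Complex.exp (k * (θ : ℂ) * Complex.I) =
      if k = 0 then 2 * (Real.pi : ℂ) else 0 := by
  rw [← integral_Ioc_eq_integral_Ioo,
    ← intervalIntegral.integral_of_le (by linarith [Real.pi_pos])]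
  split_ifs with hk
  · simp only [hk, Int.cast_zero, zero_mul, Complex.exp_zero, intervalIntegral.integral_const,
      Complex.real_smul]
    push_cast; ring
  · have hk' : (k : ℂ) * Complex.I ≠ 0 := mul_ne_zero (by exact_mod_cast hk) Complex.I_ne_zero
    have h := integral_exp_mul_complex (a := -Real.pi) (b := Real.pi) hk'
    have e : ∀ θ : ℝ, (k : ℂ) * θ * Complex.I = k * Complex.I * θ := fun θ => by ring
    simp only [e]
    rw [h, div_eq_zero_iff]
    left
    rw [sub_eq_zero, Complex.exp_eq_exp_iff_exists_int]
    exact ⟨k, by push_cast; ring⟩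

/-- Parseval's identity for an absolutely convergent one-sided Fourier series. -/
theorem integral_norm_sq_tsum_exp (a : ℕ → ℂ) (ha : Summable fun n => ‖a n‖) :
    ∫ θ in Ioo (-Real.pi) Real.pi, ‖∑' n, a n * Complex.exp (n * (θ : ℂ) * Complex.I)‖ ^ 2 =
      2 * Real.pi * ∑' n, ‖a n‖ ^ 2 := by
  set m : Measure ℝ := volume.restrict (Ioo (-Real.pi) Real.pi) with hm
  have : IsFiniteMeasure m := ⟨by simp [hm]⟩
  set h : ℝ → ℂ := fun θ => ∑' n, a n * Complex.exp (n * (θ : ℂ) * Complex.I) with hh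
  have nexp : ∀ (n : ℕ) (θ : ℝ), ‖Complex.exp (n * (θ : ℂ) * Complex.I)‖ = 1 := fun n θ => by
    have := Complex.norm_exp_ofReal_mul_I (n * θ)
    push_cast at this; exact this
  have hbound : ∀ θ, ‖h θ‖ ≤ ∑' n, ‖a n‖ := fun θ =>
    tsum_of_norm_bounded ha.hasSum (fun n => by rw [norm_mul, nexp, mul_one])
  have hcont : Continuous h := by
    refine continuous_tsum (u := fun n => ‖a n‖) (fun n => by fun_prop) ha (fun n θ => ?_)
    rw [norm_mul, nexp, mul_one]
  have coeff : ∀ n : ℕ, ∫ θ, Complex.exp (-(n * (θ : ℂ) * Complex.I)) * h θ ∂m =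
      2 * Real.pi * a n := by
    intro n
    have e1 : ∀ θ : ℝ, Complex.exp (-(n * (θ : ℂ) * Complex.I)) * h θ =
        ∑' k : ℕ, a k * Complex.exp (((k - n : ℤ) : ℂ) * θ * Complex.I) := by
      intro θ
      simp only [hh, ← tsum_mul_left]
      congr 1; ext k
      rw [mul_left_comm, ← Complex.exp_add]
      congr 2; push_cast; ring
    have nexp' : ∀ (k : ℤ) (θ : ℝ), ‖Complex.exp ((k : ℂ) * (θ : ℂ) * Complex.I)‖ = 1 := by
      intro k θ
      have := Complex.norm_exp_ofReal_mul_I (k * θ)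
      push_cast at this; exact this
    have H := hasSum_integral_of_summable_integral_norm (μ := m)
      (F := fun (k : ℕ) (θ : ℝ) => a k * Complex.exp (((k - n : ℤ) : ℂ) * θ * Complex.I))
      (fun k => Integrable.of_bound (C := ‖a k‖)
        (Continuous.aestronglyMeasurable (by fun_prop))
        (Filter.Eventually.of_forall fun θ => by rw [norm_mul, nexp', mul_one]))
      (by simp only [norm_mul, nexp', mul_one, integral_const]
          exact ha.const_smul _)
    simp only [e1]
    rw [← H.tsum_eq, tsum_eq_single n]
    · rw [integral_const_mul, hm, integral_exp_int_mul_I]; simp; ring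
    · intro k hk
      rw [integral_const_mul, hm, integral_exp_int_mul_I, if_neg (by omega), mul_zero]
  have nexp2 : ∀ (n : ℕ) (θ : ℝ), ‖Complex.exp (-(n * (θ : ℂ) * Complex.I))‖ = 1 := fun n θ => by
    rw [Complex.exp_neg, norm_inv, nexp, inv_one]
  -- Only the conjugated factor of |h|² is expanded, so that termwise integration produces the
  -- Fourier coefficients of h already computed in `coeff`.
  have e2 : ∀ θ, ((‖h θ‖ ^ 2 : ℝ) : ℂ) =
      ∑' n : ℕ, conj (a n) * (Complex.exp (-(n * (θ : ℂ) * Complex.I)) * h θ) := by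
    intro θ
    have e3 : ∀ n : ℕ, conj (a n) * (Complex.exp (-(n * (θ : ℂ) * Complex.I)) * h θ) =
        conj (a n * Complex.exp (n * (θ : ℂ) * Complex.I)) * h θ := by
      intro n
      rw [map_mul, ← Complex.exp_conj]
      simp [mul_assoc]
    simp only [e3, tsum_mul_right]
    rw [← Complex.conj_tsum, ← Complex.normSq_eq_conj_mul_self, Complex.normSq_eq_norm_sq]
  have H := hasSum_integral_of_summable_integral_norm (μ := m)
      (F := fun (n : ℕ) (θ : ℝ) =>
        conj (a n) * (Complex.exp (-(n * (θ : ℂ) * Complex.I)) * h θ))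
      (fun n => Integrable.of_bound (C := ‖a n‖ * ∑' n, ‖a n‖)
        (Continuous.aestronglyMeasurable (by fun_prop))
        (Filter.Eventually.of_forall fun θ => by
          rw [norm_mul, norm_mul, nexp2, one_mul, RCLike.norm_conj]
          exact mul_le_mul_of_nonneg_left (hbound θ) (norm_nonneg _)))
      (by simp only [norm_mul, nexp2, one_mul, RCLike.norm_conj, integral_const_mul]
          exact ha.mul_right _)
  have : ((∫ θ, ‖h θ‖ ^ 2 ∂m : ℝ) : ℂ) = ((2 * Real.pi * ∑' n, ‖a n‖ ^ 2 : ℝ) : ℂ) := by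
    rw [← integral_complex_ofReal]
    simp only [e2]
    rw [← H.tsum_eq]
    simp only [integral_const_mul, coeff]
    push_cast
    rw [← tsum_mul_left]
    congr 1; ext n
    rw [mul_left_comm, ← Complex.normSq_eq_conj_mul_self, Complex.normSq_eq_norm_sq]
    push_cast; rfl
  exact Complex.ofReal_injective this

theorem lintegral_norm_sq_tsum_exp (a : ℕ → ℂ) (ha : Summable fun n => ‖a n‖) :
    ∫⁻ θ in Ioo (-Real.pi) Real.pi, ‖∑' n, a n * Complex.exp (n * (θ : ℂ) * Complex.I)‖ₑ ^ 2 =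
      ENNReal.ofReal (2 * Real.pi) * ∑' n, ‖a n‖ₑ ^ 2 := by
  have h2 : Summable fun n => ‖a n‖ ^ 2 := by
    have := ha.mul_norm ha
    simpa [sq, Function.comp_def] using (this.comp_injective (i := fun n : ℕ => (n, n))
      (fun x y h => by simpa using h))
  have hcont : Continuous fun θ : ℝ => ∑' n, a n * Complex.exp (n * (θ : ℂ) * Complex.I) := by
    refine continuous_tsum (u := fun n => ‖a n‖) (fun n => by fun_prop) ha (fun n θ => ?_)
    have := Complex.norm_exp_ofReal_mul_I (n * θ)
    push_cast at this
    rw [norm_mul, this, mul_one]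
  have e : ∀ x : ℂ, ‖x‖ₑ ^ 2 = ENNReal.ofReal (‖x‖ ^ 2) := fun x => by
    rw [ENNReal.ofReal_pow (norm_nonneg _), ofReal_norm]
  simp only [e]
  rw [← ofReal_integral_eq_lintegral_ofReal, integral_norm_sq_tsum_exp a ha,
    ENNReal.ofReal_mul (by positivity), ENNReal.ofReal_tsum_of_nonneg (fun n => by positivity) h2]
  · have : IntegrableOn (fun θ : ℝ =>
        ‖∑' n, a n * Complex.exp (n * (θ : ℂ) * Complex.I)‖ ^ 2) (Icc (-Real.pi) Real.pi) :=
      (hcont.norm.pow 2).continuousOn.integrableOn_compact isCompact_Icc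
    exact this.mono_set Ioo_subset_Icc_self
  · exact Filter.Eventually.of_forall fun θ => by positivity

/-! ### Power series on the disc and radial weights. -/

theorem measurableSet_disc : MeasurableSet disc := Metric.isOpen_ball.measurableSet

theorem isOpen_disc : IsOpen disc := Metric.isOpen_ball

theorem mem_disc {z : ℂ} : z ∈ disc ↔ ‖z‖ < 1 := by simp [disc]

theorem lintegral_areaMeasure (F : ℂ → ℝ≥0∞) :
    ∫⁻ z, F z ∂areaMeasure = (ENNReal.ofReal Real.pi)⁻¹ * ∫⁻ z in disc, F z := by
  rw [areaMeasure, lintegral_smul_measure, smul_eq_mul]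

/-- The norm of a power series in `L²` of the disc with a radial weight. -/
theorem lintegral_areaMeasure_norm_sq_mul_radial {h : ℂ → ℂ} {a : ℕ → ℂ}
    (hc : ContinuousOn h disc) (hh : ∀ z ∈ disc, HasSum (fun n => a n * z ^ n) (h z))
    {ρ : ℝ → ℝ≥0∞} (hρ : Measurable ρ) :
    ∫⁻ z, ‖h z‖ₑ ^ 2 * ρ ‖z‖ ∂areaMeasure =
      ∑' n, ‖a n‖ₑ ^ 2 * (2 * ∫⁻ r in Ioo (0 : ℝ) 1, ENNReal.ofReal (r ^ (2 * n + 1)) * ρ r) := by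
  have hmeas : Measurable (disc.indicator h) := by
    classical
    have := hc.measurable_piecewise (g := fun _ => (0 : ℂ)) continuousOn_const measurableSet_disc
    exact (piecewise_eq_indicator (f := h) (s := disc)) ▸ this
  have hmeas2 : Measurable fun z : ℂ => ‖disc.indicator h z‖ₑ ^ 2 * ρ ‖z‖ := by fun_prop
  have e1 : ∫⁻ z in disc, ‖h z‖ₑ ^ 2 * ρ ‖z‖ = ∫⁻ z, ‖disc.indicator h z‖ₑ ^ 2 * ρ ‖z‖ := by
    rw [← lintegral_indicator measurableSet_disc]
    congr 1; ext z
    by_cases hz : z ∈ disc <;> simp [hz]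
  have hpc : Measurable fun p : ℝ × ℝ => Complex.polarCoord.symm p := by
    simp only [Complex.polarCoord_symm_apply]; fun_prop
  -- Parseval on the circle of radius r with coefficients a_n rⁿ; the polar Jacobian r raises the
  -- exponent to 2n + 1, and circles outside the disc contribute nothing.
  have inner : ∀ r ∈ Ioi (0 : ℝ), ∫⁻ θ in Ioo (-Real.pi) Real.pi, ENNReal.ofReal r •
        (‖disc.indicator h (Complex.polarCoord.symm (r, θ))‖ₑ ^ 2 *
          ρ ‖Complex.polarCoord.symm (r, θ)‖) =
      (Ioo (0 : ℝ) 1).indicator (fun r => ENNReal.ofReal (2 * Real.pi) *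
        ∑' n, ‖a n‖ₑ ^ 2 * (ENNReal.ofReal (r ^ (2 * n + 1)) * ρ r)) r := by
    intro r hr
    have hr0 : 0 < r := hr
    have hn : ∀ θ, ‖Complex.polarCoord.symm (r, θ)‖ = r := fun θ => by
      simp [abs_of_pos hr0]
    by_cases h1 : r < 1
    · rw [indicator_of_mem (by exact ⟨hr0, h1⟩)]
      have hz : ∀ θ, Complex.polarCoord.symm (r, θ) ∈ disc := fun θ => by rw [mem_disc, hn]; exact h1
      have hexp : ∀ θ, h (Complex.polarCoord.symm (r, θ)) =
          ∑' n, (a n * r ^ n) * Complex.exp (n * (θ : ℂ) * Complex.I) := by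
        intro θ
        rw [← (hh _ (hz θ)).tsum_eq]
        congr 1; ext n
        rw [Complex.polarCoord_symm_apply, mul_pow]
        simp only
        rw [Complex.ofReal_cos, Complex.ofReal_sin, ← Complex.exp_mul_I, ← Complex.exp_nat_mul,
          mul_assoc, mul_assoc (n : ℂ)]
      have hsum : Summable fun n => ‖a n * (r : ℂ) ^ n‖ := by
        have : ((r : ℝ) : ℂ) ∈ disc := by rw [mem_disc]; simpa [abs_of_pos hr0] using h1
        exact (hh _ this).summable.norm
      simp only [hn, hz, indicator_of_mem, smul_eq_mul]
      rw [lintegral_const_mul', lintegral_mul_const'']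
      · simp only [hexp]
        rw [lintegral_norm_sq_tsum_exp _ hsum, mul_assoc, mul_left_comm, ← ENNReal.tsum_mul_right,
          ← ENNReal.tsum_mul_left]
        congr 2; ext n
        have : ‖a n * (r : ℂ) ^ n‖ₑ ^ 2 = ‖a n‖ₑ ^ 2 * ENNReal.ofReal (r ^ (2 * n)) := by
          rw [enorm_mul, mul_pow, enorm_pow, ← ofReal_norm (r : ℂ), Complex.norm_real,
            Real.norm_of_nonneg hr0.le, ← pow_mul, ← ENNReal.ofReal_pow hr0.le, mul_comm n 2]
        rw [this, pow_succ r, ENNReal.ofReal_mul (by positivity)]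
        ring
      · have e : (fun θ : ℝ => ‖h (Complex.polarCoord.symm (r, θ))‖ₑ ^ 2) =
            fun θ : ℝ => ‖disc.indicator h (Complex.polarCoord.symm (r, θ))‖ₑ ^ 2 := by
          ext θ; rw [indicator_of_mem (hz θ)]
        rw [e]
        have : Measurable fun θ : ℝ => disc.indicator h (Complex.polarCoord.symm (r, θ)) :=
          hmeas.comp (hpc.comp (by fun_prop))
        exact (this.enorm.pow_const 2).aemeasurable
      · exact ENNReal.ofReal_ne_top
    · rw [indicator_of_notMem (by simp [h1])]
      have hz : ∀ θ, Complex.polarCoord.symm (r, θ) ∉ disc := fun θ => by rw [mem_disc, hn]; exact h1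
      simp only [indicator_of_notMem (hz _)]
      simp
  rw [lintegral_areaMeasure, e1, ← Complex.lintegral_comp_polarCoord_symm, polarCoord_target,
    Measure.volume_eq_prod, ← Measure.prod_restrict, lintegral_prod]
  · rw [setLIntegral_congr_fun measurableSet_Ioi inner]
    rw [lintegral_indicator measurableSet_Ioo, Measure.restrict_restrict measurableSet_Ioo,
      inter_eq_left.2 Ioo_subset_Ioi_self, lintegral_const_mul', lintegral_tsum]
    · rw [← mul_assoc, ENNReal.ofReal_mul zero_le_two, ← mul_assoc, mul_comm _ (ENNReal.ofReal 2),
        mul_assoc (ENNReal.ofReal 2), ENNReal.inv_mul_cancel, mul_one, ← ENNReal.tsum_mul_left]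
      · congr 1; ext n
        rw [lintegral_const_mul']
        · simp only [ENNReal.ofReal_ofNat]; ring
        · exact ENNReal.pow_ne_top enorm_ne_top
      · simp [Real.pi_pos]
      · simp
    · intro n; fun_prop
    · exact ENNReal.ofReal_ne_top
  · refine Measurable.aemeasurable ?_
    exact (by fun_prop : Measurable fun p : ℝ × ℝ => ENNReal.ofReal p.1).smul (hmeas2.comp hpc)

theorem hasSum_taylorCoeff {f : ℂ → ℂ} (hf : DifferentiableOn ℂ f disc) {z : ℂ} (hz : z ∈ disc) :
    HasSum (fun n => taylorCoeff f n * z ^ n) (f z) := by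
  have h := Complex.hasSum_taylorSeries_on_ball hf hz
  have e : (fun n => taylorCoeff f n * z ^ n) =
      fun n => ((n.factorial : ℂ))⁻¹ • (z - 0) ^ n • iteratedDeriv n f 0 := by
    ext n; simp only [taylorCoeff, smul_eq_mul, sub_zero]; ring
  rwa [e]

/-- Convergence at a real point r < 1 makes |a_n| rⁿ tend to 0, which forces the radius to be at
least 1. Holomorphy and uniqueness of Taylor coefficients follow from this. -/
theorem hasFPowerSeriesOnBall_ofScalars {f : ℂ → ℂ} {a : ℕ → ℂ}
    (h : ∀ z ∈ disc, HasSum (fun n => a n * z ^ n) (f z)) :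
    HasFPowerSeriesOnBall f (FormalMultilinearSeries.ofScalars ℂ a) 0 1 where
  r_le := by
    refine ENNReal.le_of_forall_nnreal_lt fun r hr => ?_
    have hr1 : (r : ℝ) < 1 := by exact_mod_cast hr
    refine FormalMultilinearSeries.le_radius_of_tendsto _ (l := 0) ?_
    have hz : ((r : ℝ) : ℂ) ∈ disc := by rw [mem_disc]; simpa using hr1
    have := (h _ hz).summable.norm.tendsto_atTop_zero
    simpa [FormalMultilinearSeries.ofScalars_norm] using this
  r_pos := one_pos
  hasSum := by
    intro y hy
    have hy' : y ∈ disc := by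
      rw [mem_disc]
      have : ‖y‖ₑ < 1 := by simpa using hy
      rw [← ofReal_norm, ENNReal.ofReal_lt_one] at this
      exact this
    simpa [FormalMultilinearSeries.ofScalars_apply_eq, mul_comm] using h y hy'

theorem differentiableOn_of_hasSum {f : ℂ → ℂ} {a : ℕ → ℂ}
    (h : ∀ z ∈ disc, HasSum (fun n => a n * z ^ n) (f z)) : DifferentiableOn ℂ f disc := by
  have := (hasFPowerSeriesOnBall_ofScalars h).differentiableOn
  refine this.mono fun z hz => ?_
  rw [mem_disc] at hz
  simp only [Metric.mem_eball, edist_zero_right, ← ofReal_norm]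
  rwa [ENNReal.ofReal_lt_one]

theorem taylorCoeff_eq_of_hasSum {f : ℂ → ℂ} {a : ℕ → ℂ}
    (h : ∀ z ∈ disc, HasSum (fun n => a n * z ^ n) (f z)) (n : ℕ) : taylorCoeff f n = a n := by
  have h1 := (hasFPowerSeriesOnBall_ofScalars h).hasFPowerSeriesAt
  have h2 := h1.eq_formalMultilinearSeries h1.analyticAt.hasFPowerSeriesAt
  have h3 := congrArg (fun p : FormalMultilinearSeries ℂ ℂ ℂ => p n fun _ => 1) h2
  simpa [FormalMultilinearSeries.ofScalars_apply_eq, taylorCoeff] using h3.symm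

theorem differentiableOn_deriv {f : ℂ → ℂ} (hf : DifferentiableOn ℂ f disc) :
    DifferentiableOn ℂ (deriv f) disc := hf.deriv isOpen_disc

theorem taylorCoeff_deriv (f : ℂ → ℂ) (n : ℕ) :
    taylorCoeff (deriv f) n = (n + 1) * taylorCoeff f (n + 1) := by
  rw [taylorCoeff, taylorCoeff, iteratedDeriv_succ', Nat.factorial_succ]
  have : (n.factorial : ℂ) ≠ 0 := by exact_mod_cast n.factorial_ne_zero
  have : (n : ℂ) + 1 ≠ 0 := by exact_mod_cast n.succ_ne_zero
  push_cast; field_simp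

theorem hasSum_deriv {f : ℂ → ℂ} (hf : DifferentiableOn ℂ f disc) {z : ℂ} (hz : z ∈ disc) :
    HasSum (fun n : ℕ => (n + 1) * taylorCoeff f (n + 1) * z ^ n) (deriv f z) := by
  simpa only [taylorCoeff_deriv] using hasSum_taylorCoeff (differentiableOn_deriv hf) hz

theorem deriv_eq_tsum_of_hasSum {f : ℂ → ℂ} {a : ℕ → ℂ}
    (h : ∀ z ∈ disc, HasSum (fun n => a n * z ^ n) (f z)) {z : ℂ} (hz : z ∈ disc) :
    HasSum (fun n : ℕ => (n + 1) * a (n + 1) * z ^ n) (deriv f z) := by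
  simpa only [taylorCoeff_eq_of_hasSum h] using hasSum_deriv (differentiableOn_of_hasSum h) hz

theorem taylorCoeff_zero (f : ℂ → ℂ) : taylorCoeff f 0 = f 0 := by simp [taylorCoeff]

/-! ### Littlewood–Paley formulas for the weights 1 - |z|² and log(1/|z|). -/

theorem lintegral_pow_mul_one_sub_sq (n : ℕ) :
    2 * ∫⁻ r in Ioo (0 : ℝ) 1, ENNReal.ofReal (r ^ (2 * n + 1)) * ENNReal.ofReal (1 - r ^ 2) =
      ENNReal.ofReal (1 / ((n + 1) * (n + 2))) := by
  have e : ∀ r ∈ Ioo (0 : ℝ) 1, ENNReal.ofReal (r ^ (2 * n + 1)) * ENNReal.ofReal (1 - r ^ 2) =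
      ENNReal.ofReal (r ^ (2 * n + 1) - r ^ (2 * n + 3)) := fun r hr => by
    rw [← ENNReal.ofReal_mul (pow_nonneg hr.1.le _)]; congr 1; ring
  rw [setLIntegral_congr_fun measurableSet_Ioo e, ← ofReal_integral_eq_lintegral_ofReal,
    ← integral_Ioc_eq_integral_Ioo, ← intervalIntegral.integral_of_le zero_le_one,
    intervalIntegral.integral_sub (by simp) (by simp), integral_pow, integral_pow,
    ← ENNReal.ofReal_ofNat, ← ENNReal.ofReal_mul zero_le_two]
  · congr 1; push_cast; field_simp; ring
  · have : IntegrableOn (fun r : ℝ => r ^ (2 * n + 1) - r ^ (2 * n + 3)) (Icc 0 1) :=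
      (by fun_prop : Continuous fun r : ℝ => r ^ (2 * n + 1) - r ^ (2 * n + 3)).continuousOn
        |>.integrableOn_compact isCompact_Icc
    exact this.mono_set Ioo_subset_Icc_self
  · refine (ae_restrict_iff' measurableSet_Ioo).2 (Filter.Eventually.of_forall fun r hr => ?_)
    have : r ^ (2 * n + 1) - r ^ (2 * n + 3) = r ^ (2 * n + 1) * (1 - r ^ 2) := by ring
    simp only [Pi.zero_apply, this]
    exact mul_nonneg (pow_nonneg hr.1.le _) (by nlinarith [hr.1, hr.2])

theorem lintegral_pow_mul_log_inv (n : ℕ) :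
    2 * ∫⁻ r in Ioo (0 : ℝ) 1, ENNReal.ofReal (r ^ (2 * n + 1)) * ENNReal.ofReal (Real.log r⁻¹) =
      ENNReal.ofReal (1 / (2 * (n + 1) ^ 2)) := by
  set k : ℝ := 2 * n + 2 with hk
  have hk0 : 0 < k := by positivity
  -- An antiderivative of -r^(2n+1) log r. The factor r log r is kept together so that continuity at
  -- 0 comes from `Real.continuous_mul_log`.
  set G : ℝ → ℝ := fun r => r ^ (2 * n + 2) / k ^ 2 - r ^ (2 * n + 1) * (r * Real.log r) / k with hG
  have hnn : ∀ r ∈ Ioo (0 : ℝ) 1, 0 ≤ -(r ^ (2 * n + 1) * Real.log r) := fun r hr => by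
    have := mul_nonneg (pow_nonneg hr.1.le (2 * n + 1)) (neg_nonneg.2 (Real.log_nonpos hr.1.le hr.2.le))
    linarith
  have hcont : ContinuousOn G (Icc 0 1) := by
    have : Continuous G := by
      have := Real.continuous_mul_log
      fun_prop
    exact this.continuousOn
  have hder : ∀ r ∈ Ioo (0 : ℝ) 1, HasDerivAt G (-(r ^ (2 * n + 1) * Real.log r)) r := by
    intro r hr
    have h1 : HasDerivAt (fun r : ℝ => r ^ (2 * n + 2) / k ^ 2 - r ^ (2 * n + 2) * Real.log r / k)
        (((2 * n + 2 : ℕ) : ℝ) * r ^ (2 * n + 1) / k ^ 2 -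
          (((2 * n + 2 : ℕ) : ℝ) * r ^ (2 * n + 1) * Real.log r + r ^ (2 * n + 2) * r⁻¹) / k) r :=
      ((hasDerivAt_pow (2 * n + 2) r).div_const _).sub
        (((hasDerivAt_pow (2 * n + 2) r).mul (Real.hasDerivAt_log hr.1.ne')).div_const _)
    have e : G = fun r : ℝ => r ^ (2 * n + 2) / k ^ 2 - r ^ (2 * n + 2) * Real.log r / k := by
      ext r; simp only [hG]; ring
    rw [e]
    convert h1 using 1
    have : ((2 * n + 2 : ℕ) : ℝ) = k := by simp [hk]
    rw [this, pow_succ r (2 * n + 1), mul_assoc (r ^ (2 * n + 1)), mul_inv_cancel₀ hr.1.ne']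
    field_simp; ring
  have hint := intervalIntegral.integrableOn_deriv_of_nonneg hcont hder hnn
  have e : ∀ r ∈ Ioo (0 : ℝ) 1, ENNReal.ofReal (r ^ (2 * n + 1)) * ENNReal.ofReal (Real.log r⁻¹) =
      ENNReal.ofReal (-(r ^ (2 * n + 1) * Real.log r)) := fun r hr => by
    rw [← ENNReal.ofReal_mul (pow_nonneg hr.1.le _), Real.log_inv]; congr 1; ring
  rw [setLIntegral_congr_fun measurableSet_Ioo e, ← ofReal_integral_eq_lintegral_ofReal,
    ← integral_Ioc_eq_integral_Ioo, ← intervalIntegral.integral_of_le zero_le_one,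
    intervalIntegral.integral_eq_sub_of_hasDerivAt_of_le zero_le_one hcont hder
      ((intervalIntegrable_iff_integrableOn_Ioc_of_le zero_le_one).2 hint),
    ← ENNReal.ofReal_ofNat, ← ENNReal.ofReal_mul zero_le_two]
  · congr 1
    simp only [hG, hk]
    simp
    field_simp
  · exact hint.mono_set Ioo_subset_Ioc_self
  · exact (ae_restrict_iff' measurableSet_Ioo).2 (Filter.Eventually.of_forall hnn)

/-- The Dirichlet integral with weight `1 - |z|²` is dominated by the Hardy norm. -/
theorem lintegral_deriv_sq_mul_one_sub_sq_le {f : ℂ → ℂ} (hf : DifferentiableOn ℂ f disc) :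
    ∫⁻ z, ‖deriv f z‖ₑ ^ 2 * ENNReal.ofReal (1 - ‖z‖ ^ 2) ∂areaMeasure ≤
      ∑' n, ‖taylorCoeff f n‖ₑ ^ 2 := by
  rw [lintegral_areaMeasure_norm_sq_mul_radial (ρ := fun r => ENNReal.ofReal (1 - r ^ 2))
    (differentiableOn_deriv hf).continuousOn (fun z hz => hasSum_deriv hf hz) (by fun_prop)]
  rw [tsum_eq_zero_add' (f := fun n => ‖taylorCoeff f n‖ₑ ^ 2) ENNReal.summable]
  refine le_trans (ENNReal.tsum_le_tsum fun n => ?_) le_add_self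
  rw [lintegral_pow_mul_one_sub_sq, enorm_mul, mul_pow, mul_right_comm]
  refine mul_le_of_le_one_left' ?_
  have : ‖(n + 1 : ℂ)‖ₑ = ENNReal.ofReal (n + 1) := by
    rw [← ofReal_norm]; congr 1
    have : (n + 1 : ℂ) = ((n + 1 : ℕ) : ℂ) := by push_cast; rfl
    rw [this, Complex.norm_natCast]; push_cast; rfl
  rw [this, ← ENNReal.ofReal_pow (by positivity), ← ENNReal.ofReal_mul (by positivity),
    ENNReal.ofReal_le_one]
  rw [mul_one_div, div_le_one (by positivity)]
  nlinarith

/-- The profile of the Green kernel with pole at the origin. -/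
noncomputable def greenRadial (r : ℝ) : ℝ≥0∞ :=
  if r = 0 then ⊤ else ENNReal.ofReal (Real.log r⁻¹)

theorem measurable_greenRadial : Measurable greenRadial :=
  Measurable.ite (measurableSet_singleton 0) measurable_const (by fun_prop)

/-- With h = F' and F = ∑ B_n z^(n+1), the right side is half the squared Hardy norm of F: the
moment 1/(2(n+1)²) of the logarithm cancels the factor (n+1)² from differentiation. -/
theorem lintegral_norm_sq_mul_greenRadial {h : ℂ → ℂ} {B : ℕ → ℂ}
    (hc : ContinuousOn h disc)
    (hh : ∀ z ∈ disc, HasSum (fun n : ℕ => (n + 1) * B n * z ^ n) (h z)) :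
    ∫⁻ z, ‖h z‖ₑ ^ 2 * greenRadial ‖z‖ ∂areaMeasure = 2⁻¹ * ∑' n, ‖B n‖ₑ ^ 2 := by
  rw [lintegral_areaMeasure_norm_sq_mul_radial hc hh measurable_greenRadial,
    ← ENNReal.tsum_mul_left]
  congr 1; ext n
  have e : ∀ r ∈ Ioo (0 : ℝ) 1, ENNReal.ofReal (r ^ (2 * n + 1)) * greenRadial r =
      ENNReal.ofReal (r ^ (2 * n + 1)) * ENNReal.ofReal (Real.log r⁻¹) := fun r hr => by
    rw [greenRadial, if_neg hr.1.ne']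
  rw [setLIntegral_congr_fun measurableSet_Ioo e, lintegral_pow_mul_log_inv, enorm_mul, mul_pow,
    mul_right_comm]
  congr 1
  have : ‖(n + 1 : ℂ)‖ₑ = ENNReal.ofReal (n + 1) := by
    rw [← ofReal_norm]; congr 1
    have : (n + 1 : ℂ) = ((n + 1 : ℕ) : ℂ) := by push_cast; rfl
    rw [this, Complex.norm_natCast]; push_cast; rfl
  rw [this, ← ENNReal.ofReal_pow (by positivity), ← ENNReal.ofReal_mul (by positivity),
    ← ENNReal.ofReal_ofNat, ← ENNReal.ofReal_inv_of_pos two_pos]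
  congr 1; field_simp

/-! ### Möbius maps and conformal invariance of the Green kernel. -/

/-- The involutive automorphism `z ↦ (w - z) / (1 - conj w z)` of the disc. -/
noncomputable def moebius (w z : ℂ) : ℂ := (w - z) / (1 - conj w * z)

theorem one_sub_mul_ne_zero {a b : ℂ} (ha : ‖a‖ ≤ 1) (hb : ‖b‖ < 1) : 1 - a * b ≠ 0 := by
  intro h
  have h1 : a * b = 1 := (sub_eq_zero.1 h).symm
  have h2 : ‖a‖ * ‖b‖ = 1 := by rw [← norm_mul, h1, norm_one]
  nlinarith [norm_nonneg a, norm_nonneg b]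

theorem one_sub_conj_mul_ne_zero {w z : ℂ} (hw : w ∈ disc) (hz : z ∈ disc) :
    1 - conj w * z ≠ 0 :=
  one_sub_mul_ne_zero (by rw [RCLike.norm_conj]; exact (mem_disc.1 hw).le) (mem_disc.1 hz)

theorem one_sub_normSq_pos {w : ℂ} (hw : w ∈ disc) : 0 < 1 - ‖w‖ ^ 2 := by
  have := mem_disc.1 hw
  nlinarith [norm_nonneg w]

theorem normSq_one_sub_conj_mul (w z : ℂ) :
    ‖1 - conj w * z‖ ^ 2 - ‖w - z‖ ^ 2 = (1 - ‖z‖ ^ 2) * (1 - ‖w‖ ^ 2) := by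
  simp only [← Complex.normSq_eq_norm_sq, Complex.normSq_apply]
  simp
  ring

theorem one_sub_normSq_moebius {w z : ℂ} (hw : w ∈ disc) (hz : z ∈ disc) :
    1 - ‖moebius w z‖ ^ 2 = (1 - ‖z‖ ^ 2) * (1 - ‖w‖ ^ 2) / ‖1 - conj w * z‖ ^ 2 := by
  have h : ‖1 - conj w * z‖ ^ 2 ≠ 0 := by
    simpa using one_sub_conj_mul_ne_zero hw hz
  rw [moebius, norm_div, div_pow, ← normSq_one_sub_conj_mul, sub_div, div_self h]

theorem moebius_mem_disc {w z : ℂ} (hw : w ∈ disc) (hz : z ∈ disc) : moebius w z ∈ disc := by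
  have h := one_sub_normSq_moebius hw hz
  have h1 := one_sub_normSq_pos hw
  have h2 := one_sub_normSq_pos hz
  have h3 : 0 < ‖1 - conj w * z‖ := norm_pos_iff.2 (one_sub_conj_mul_ne_zero hw hz)
  have h4 : 0 < 1 - ‖moebius w z‖ ^ 2 := by rw [h]; positivity
  rw [mem_disc]
  nlinarith [norm_nonneg (moebius w z)]

theorem one_sub_conj_mul_self (w : ℂ) : 1 - conj w * w = ((1 - ‖w‖ ^ 2 : ℝ) : ℂ) := by
  rw [← Complex.normSq_eq_conj_mul_self, Complex.normSq_eq_norm_sq]; push_cast; rfl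

theorem one_sub_conj_mul_self_ne_zero {w : ℂ} (hw : w ∈ disc) : 1 - conj w * w ≠ 0 :=
  one_sub_conj_mul_ne_zero hw hw

theorem one_sub_conj_mul_moebius {w z : ℂ} (hw : w ∈ disc) (hz : z ∈ disc) :
    1 - conj w * moebius w z = (1 - conj w * w) / (1 - conj w * z) := by
  have h := one_sub_conj_mul_ne_zero hw hz
  rw [moebius, eq_div_iff h, sub_mul, mul_assoc, div_mul_cancel₀ _ h]
  ring

theorem moebius_sub {w z : ℂ} (hw : w ∈ disc) (hz : z ∈ disc) :
    moebius w z - w = -z * ((1 - conj w * w) / (1 - conj w * z)) := by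
  have h := one_sub_conj_mul_ne_zero hw hz
  rw [moebius, mul_div_assoc', eq_div_iff h, sub_mul, div_mul_cancel₀ _ h]
  ring

theorem moebius_moebius {w z : ℂ} (hw : w ∈ disc) (hz : z ∈ disc) :
    moebius w (moebius w z) = z := by
  have h1 := one_sub_conj_mul_ne_zero hw hz
  have h2 := one_sub_conj_mul_self_ne_zero hw
  rw [moebius, one_sub_conj_mul_moebius hw hz, ← neg_sub, moebius_sub hw hz,
    neg_mul, neg_neg, mul_div_cancel_right₀ _ (div_ne_zero h2 h1)]

theorem hasDerivAt_moebius {w z : ℂ} (hw : w ∈ disc) (hz : z ∈ disc) :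
    HasDerivAt (moebius w) (-(1 - conj w * w) / (1 - conj w * z) ^ 2) z := by
  have h1 := one_sub_conj_mul_ne_zero hw hz
  have h := ((hasDerivAt_id z).const_sub w).div (((hasDerivAt_id z).const_mul (conj w)).const_sub 1) h1
  refine h.congr_deriv ?_
  simp only [id]
  congr 1; ring

/-- Conformal invariance: φ_w sends 0 to the pole w, so the Green kernel pulls back to its radial
profile, including the value ∞ at the pole. -/
theorem greenKernel_moebius {w z : ℂ} (hw : w ∈ disc) (hz : z ∈ disc) :
    greenKernel (moebius w z) w = greenRadial ‖z‖ := by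
  have h1 := one_sub_conj_mul_ne_zero hw hz
  have h2 := one_sub_conj_mul_self_ne_zero hw
  have h3 := moebius_sub hw hz
  rw [greenKernel, greenRadial]
  by_cases hz0 : z = 0
  · subst hz0
    have : moebius w 0 = w := by simp [moebius]
    simp [this]
  · have hne : moebius w z ≠ w := by
      rw [← sub_ne_zero, h3]
      exact mul_ne_zero (neg_ne_zero.2 hz0) (div_ne_zero h2 h1)
    rw [if_neg hne, if_neg (norm_ne_zero_iff.2 hz0), h3, one_sub_conj_mul_moebius hw hz]
    congr 2
    rw [div_mul_cancel_right₀ (div_ne_zero h2 h1), norm_inv, norm_neg]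

theorem image_moebius_disc {w : ℂ} (hw : w ∈ disc) : moebius w '' disc = disc := by
  ext z
  exact ⟨fun ⟨y, hy, h⟩ => h ▸ moebius_mem_disc hw hy,
    fun hz => ⟨moebius w z, moebius_mem_disc hw hz, moebius_moebius hw hz⟩⟩

theorem injOn_moebius {w : ℂ} (hw : w ∈ disc) : InjOn (moebius w) disc := fun x hx y hy h => by
  rw [← moebius_moebius hw hx, h, moebius_moebius hw hy]

theorem det_restrictScalars_toSpanSingleton (a : ℂ) :
    ((ContinuousLinearMap.toSpanSingleton ℂ a : ℂ →L[ℂ] ℂ).restrictScalars ℝ).det = ‖a‖ ^ 2 := by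
  have : ((ContinuousLinearMap.toSpanSingleton ℂ a : ℂ →L[ℂ] ℂ).restrictScalars ℝ).det =
    LinearMap.det (((ContinuousLinearMap.toSpanSingleton ℂ a : ℂ →L[ℂ] ℂ) : ℂ →ₗ[ℂ] ℂ).restrictScalars ℝ) := rfl
  rw [this, LinearMap.det_restrictScalars, LinearMap.det_ring, Algebra.norm_complex_eq]
  simp [Complex.normSq_eq_norm_sq]

theorem lintegral_image_eq_lintegral_norm_deriv_sq {φ φ' : ℂ → ℂ} {s : Set ℂ}
    (hs : MeasurableSet s) (hφ : ∀ z ∈ s, HasDerivAt φ (φ' z) z) (hi : InjOn φ s) (G : ℂ → ℝ≥0∞) :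
    ∫⁻ z in φ '' s, G z = ∫⁻ z in s, ‖φ' z‖ₑ ^ 2 * G (φ z) := by
  rw [lintegral_image_eq_lintegral_abs_det_fderiv_mul volume hs
    (fun z hz => ((hφ z hz).hasFDerivAt.restrictScalars ℝ).hasFDerivWithinAt) hi]
  congr 1; ext z
  rw [det_restrictScalars_toSpanSingleton, abs_of_nonneg (by positivity),
    ENNReal.ofReal_pow (norm_nonneg _), ofReal_norm]

/-- Transport of a Green-weighted integral to the origin by a Möbius map. -/
theorem lintegral_norm_sq_mul_greenKernel {w : ℂ} (hw : w ∈ disc) {h : ℂ → ℂ} {B : ℕ → ℂ}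
    (hc : ContinuousOn h disc)
    (hh : ∀ z ∈ disc, HasSum (fun n : ℕ => (n + 1) * B n * z ^ n)
      (h (moebius w z) * (-(1 - conj w * w) / (1 - conj w * z) ^ 2))) :
    ∫⁻ z, ‖h z‖ₑ ^ 2 * greenKernel z w ∂areaMeasure = 2⁻¹ * ∑' n, ‖B n‖ₑ ^ 2 := by
  have hcφ : ContinuousOn (moebius w) disc := fun z hz =>
    (hasDerivAt_moebius hw hz).continuousAt.continuousWithinAt
  have hc2 : ContinuousOn
      (fun z => h (moebius w z) * (-(1 - conj w * w) / (1 - conj w * z) ^ 2)) disc := by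
    refine (hc.comp hcφ fun z hz => moebius_mem_disc hw hz).mul
      (continuousOn_const.div (by fun_prop) fun z hz => ?_)
    exact pow_ne_zero _ (one_sub_conj_mul_ne_zero hw hz)
  rw [← lintegral_norm_sq_mul_greenRadial hc2 hh, lintegral_areaMeasure, lintegral_areaMeasure]
  congr 1
  conv_lhs => rw [← image_moebius_disc hw]
  rw [lintegral_image_eq_lintegral_norm_deriv_sq measurableSet_disc
    (fun z hz => hasDerivAt_moebius hw hz) (injOn_moebius hw)]
  refine setLIntegral_congr_fun measurableSet_disc fun z hz => ?_
  rw [greenKernel_moebius hw hz, enorm_mul, mul_pow]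
  ring

theorem hasSum_succ_mul_geometric {x : ℂ} (hx : ‖x‖ < 1) :
    HasSum (fun n : ℕ => (n + 1) * x ^ n) (1 / (1 - x) ^ 2) := by
  simpa using hasSum_choose_mul_geometric_of_norm_lt_one 1 hx

/-- The transport formula with h = 1, where B_n = -(1-|w|²) w̄ⁿ, reduces this to a geometric series.
It makes ω integrable over the disc, hence finite almost everywhere. -/
theorem lintegral_greenKernel_le {w : ℂ} (hw : w ∈ disc) :
    ∫⁻ z, greenKernel z w ∂areaMeasure ≤ ENNReal.ofReal (1 - ‖w‖ ^ 2) := by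
  have hw1 := mem_disc.1 hw
  have h := lintegral_norm_sq_mul_greenKernel hw (h := fun _ => 1)
    (B := fun n => -(1 - conj w * w) * conj w ^ n) continuousOn_const (fun z hz => by
      have hx : ‖conj w * z‖ < 1 := by
        rw [norm_mul, RCLike.norm_conj]
        nlinarith [mem_disc.1 hz, norm_nonneg w, norm_nonneg z]
      have := (hasSum_succ_mul_geometric hx).mul_left (-(1 - conj w * w))
      rw [one_mul, ← mul_one_div]
      refine this.congr_fun fun n => ?_
      rw [mul_pow]; ring)
  simp only [enorm_one, one_pow, one_mul] at h
  rw [h]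
  have hp := one_sub_normSq_pos hw
  have e : ∀ n : ℕ, ‖-(1 - conj w * w) * conj w ^ n‖ₑ ^ 2 =
      ENNReal.ofReal ((1 - ‖w‖ ^ 2) ^ 2 * (‖w‖ ^ 2) ^ n) := fun n => by
    rw [← ofReal_norm, ← ENNReal.ofReal_pow (norm_nonneg _)]
    congr 1
    rw [norm_mul, norm_neg, one_sub_conj_mul_self, Complex.norm_real, Real.norm_of_nonneg hp.le,
      norm_pow, RCLike.norm_conj, mul_pow]
    ring
  have hw2 : ‖w‖ ^ 2 < 1 := by linarith
  simp only [e]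
  rw [← ENNReal.ofReal_tsum_of_nonneg (fun n => by positivity)
    ((summable_geometric_of_lt_one (by positivity) hw2).mul_left _), tsum_mul_left,
    tsum_geometric_of_lt_one (by positivity) hw2]
  refine (mul_le_of_le_one_left' (by simp)).trans (ENNReal.ofReal_le_ofReal ?_)
  rw [sq, mul_assoc, mul_inv_cancel₀ hp.ne', mul_one]

/-! ### Comparison of V_μ with the Green potential. -/

theorem one_sub_sq_le_two_mul_log_inv {x : ℝ} (hx : 0 < x) : 1 - x ^ 2 ≤ 2 * Real.log x⁻¹ := by
  have := Real.log_le_sub_one_of_pos (pow_pos hx 2)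
  rw [Real.log_pow] at this
  rw [Real.log_inv]; push_cast at this; linarith

/-- The kernel `(1 - |z|²)(1 - |w|²) / |1 - z conj w|²`. -/
noncomputable def berezinKernel (z w : ℂ) : ℝ :=
  (1 - ‖z‖ ^ 2) * (1 - ‖w‖ ^ 2) / ‖1 - z * conj w‖ ^ 2

/-- This ties V_μ to ω: with t = |φ_w(z)|, the integrand of V_μ is 1 - t² while the Green kernel is
log(1/t). -/
theorem berezinKernel_eq {z w : ℂ} (hz : z ∈ disc) (hw : w ∈ disc) :
    berezinKernel z w = 1 - ‖moebius w z‖ ^ 2 := by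
  rw [one_sub_normSq_moebius hw hz, berezinKernel, mul_comm z]

theorem berezinKernel_nonneg {z w : ℂ} (hz : z ∈ disc) (hw : w ∈ disc) :
    0 ≤ berezinKernel z w :=
  div_nonneg (mul_nonneg (one_sub_normSq_pos hz).le (one_sub_normSq_pos hw).le) (by positivity)

theorem ofReal_berezinKernel_le {z w : ℂ} (hz : z ∈ disc) (hw : w ∈ disc) :
    ENNReal.ofReal (berezinKernel z w) ≤ 2 * greenKernel z w := by
  have hm := moebius_mem_disc hw hz
  have h := greenKernel_moebius hw hm
  rw [moebius_moebius hw hz] at h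
  rw [h, greenRadial, berezinKernel_eq hz hw]
  split_ifs with h0
  · simp
  · rw [← ENNReal.ofReal_ofNat, ← ENNReal.ofReal_mul zero_le_two]
    exact ENNReal.ofReal_le_ofReal
      (one_sub_sq_le_two_mul_log_inv (lt_of_le_of_ne (norm_nonneg _) (Ne.symm h0)))

theorem measurable_greenKernel : Measurable fun p : ℂ × ℂ => greenKernel p.1 p.2 := by
  unfold greenKernel
  exact Measurable.ite (measurableSet_eq_fun measurable_fst measurable_snd) measurable_const
    (by fun_prop)

theorem measurable_berezinKernel : Measurable fun p : ℂ × ℂ => berezinKernel p.1 p.2 := by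
  unfold berezinKernel; fun_prop

/-- The measure (1-|w|²) dμ is finite, and dividing by its positive density recovers μ on the disc.
This is what licenses Tonelli for a Riesz measure that may be infinite. -/
theorem sFinite_restrict_disc {μ : Measure ℂ}
    (hμ : ∫⁻ w in disc, ENNReal.ofReal (1 - ‖w‖ ^ 2) ∂μ < ⊤) : SFinite (μ.restrict disc) := by
  have hm : Measurable fun w : ℂ => ENNReal.ofReal (1 - ‖w‖ ^ 2) := by fun_prop
  have : IsFiniteMeasure ((μ.restrict disc).withDensity fun w => ENNReal.ofReal (1 - ‖w‖ ^ 2)) :=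
    isFiniteMeasure_withDensity hμ.ne
  rw [← withDensity_inv_same (μ := μ.restrict disc) hm]
  · infer_instance
  · refine (ae_restrict_iff' measurableSet_disc).2 (Filter.Eventually.of_forall fun w hw => ?_)
    simpa using one_sub_normSq_pos hw
  · exact Filter.Eventually.of_forall fun w => ENNReal.ofReal_ne_top

/-- The function `V_μ` with values in `[0, ∞]`. -/
noncomputable def lintegralV (μ : Measure ℂ) (z : ℂ) : ℝ≥0∞ :=
  ∫⁻ w in disc, ENNReal.ofReal (berezinKernel z w) ∂μ

theorem measurable_lintegralV (μ : Measure ℂ) [SFinite (μ.restrict disc)] :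
    Measurable (lintegralV μ) :=
  measurable_berezinKernel.ennreal_ofReal.lintegral_prod_right'

theorem one_sub_norm_le_norm_one_sub_mul {z w : ℂ} (hw : ‖w‖ ≤ 1) :
    1 - ‖z‖ ≤ ‖1 - z * conj w‖ := by
  have h := norm_sub_norm_le (1 : ℂ) (z * conj w)
  rw [norm_one, norm_mul, RCLike.norm_conj] at h
  nlinarith [norm_nonneg z]

theorem lintegralV_lt_top {μ : Measure ℂ}
    (hμ : ∫⁻ w in disc, ENNReal.ofReal (1 - ‖w‖ ^ 2) ∂μ < ⊤) {z : ℂ} (hz : z ∈ disc) :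
    lintegralV μ z < ⊤ := by
  have hz1 := mem_disc.1 hz
  calc lintegralV μ z
      ≤ ∫⁻ w in disc, ENNReal.ofReal ((1 - ‖z‖ ^ 2) / (1 - ‖z‖) ^ 2) *
          ENNReal.ofReal (1 - ‖w‖ ^ 2) ∂μ := by
        refine setLIntegral_mono' measurableSet_disc fun w hw => ?_
        have h1 := one_sub_normSq_pos hz
        have h2 := one_sub_normSq_pos hw
        rw [← ENNReal.ofReal_mul (by positivity)]
        refine ENNReal.ofReal_le_ofReal ?_
        rw [berezinKernel, div_mul_eq_mul_div]
        have h3 : 0 < 1 - ‖z‖ := by linarith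
        gcongr
        exact one_sub_norm_le_norm_one_sub_mul (mem_disc.1 hw).le
    _ < ⊤ := by
        rw [lintegral_const_mul' _ _ ENNReal.ofReal_ne_top]
        exact ENNReal.mul_lt_top ENNReal.ofReal_lt_top hμ

theorem V_eq_toReal {μ : Measure ℂ} {z : ℂ} (hz : z ∈ disc) :
    V μ z = (lintegralV μ z).toReal := by
  have hV : V μ z = ∫ w in disc, berezinKernel z w ∂μ := rfl
  rw [hV, lintegralV, integral_eq_lintegral_of_nonneg_ae]
  · exact (ae_restrict_iff' measurableSet_disc).2
      (Filter.Eventually.of_forall fun w hw => berezinKernel_nonneg hz hw)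
  · have : Measurable (berezinKernel z) := by unfold berezinKernel; fun_prop
    exact this.aestronglyMeasurable

theorem lintegralV_le_two_mul_greenPotential (μ : Measure ℂ) {z : ℂ} (hz : z ∈ disc) :
    lintegralV μ z ≤ 2 * greenPotential μ z := by
  rw [greenPotential, ← lintegral_const_mul' _ _ (by simp)]
  exact setLIntegral_mono' measurableSet_disc fun w hw => ofReal_berezinKernel_le hz hw

theorem ofReal_mul_mem_disc {e : ℂ} (he : ‖e‖ = 1) {r : ℝ} (hr : 0 ≤ r) (hr1 : r < 1) :
    (r : ℂ) * e ∈ disc := by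
  rw [mem_disc, norm_mul, he, Complex.norm_real, Real.norm_of_nonneg hr]; linarith

/-! ### From area integrals to integrals along a radius. -/

/-- A Harnack-type bound. Moving from re to a point within (1-r)/2 costs a factor 4 in 1 - |z|² and
a factor 3/2 in |1 - z w̄|, since |1 - r e w̄| ≥ 1 - r; altogether 4 · (3/2)² = 9. -/
theorem berezinKernel_le_nine_mul {e : ℂ} (he : ‖e‖ = 1) {r : ℝ} (hr : 0 < r) (hr1 : r < 1)
    {z w : ℂ} (hz : ‖z - r * e‖ < (1 - r) / 2) (hw : w ∈ disc) :
    berezinKernel (r * e) w ≤ 9 * berezinKernel z w := by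
  have hre : ‖(r : ℂ) * e‖ = r := by
    rw [norm_mul, he, Complex.norm_real, Real.norm_of_nonneg hr.le, mul_one]
  have hzn : ‖z‖ ≤ r + (1 - r) / 2 := by
    have := norm_sub_norm_le z (r * e)
    rw [hre] at this; linarith
  have hw1 := one_sub_normSq_pos hw
  have hA : (1 - r ^ 2) ≤ 4 * (1 - ‖z‖ ^ 2) := by nlinarith [norm_nonneg z]
  have hl := one_sub_norm_le_norm_one_sub_mul (z := (r : ℂ) * e) (mem_disc.1 hw).le
  rw [hre] at hl
  have hB : ‖1 - z * conj w‖ ≤ 3 / 2 * ‖1 - r * e * conj w‖ := by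
    have e1 : 1 - z * conj w = (1 - r * e * conj w) - (z - r * e) * conj w := by ring
    have h2 : ‖(z - r * e) * conj w‖ ≤ (1 - r) / 2 := by
      rw [norm_mul, RCLike.norm_conj]
      nlinarith [norm_nonneg (z - r * e), norm_nonneg w, mem_disc.1 hw]
    rw [e1]
    refine (norm_sub_le _ _).trans ?_
    linarith
  have hz1 : z ∈ disc := by rw [mem_disc]; linarith
  have hp1 : 0 < ‖1 - z * conj w‖ := by
    have := one_sub_norm_le_norm_one_sub_mul (z := z) (mem_disc.1 hw).le
    have := mem_disc.1 hz1
    linarith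
  have hp2 : 0 < ‖1 - r * e * conj w‖ := by linarith
  rw [berezinKernel, berezinKernel, hre, mul_div_assoc', div_le_div_iff₀ (by positivity) (by positivity)]
  have hB2 : ‖1 - z * conj w‖ ^ 2 ≤ 9 / 4 * ‖1 - r * e * conj w‖ ^ 2 := by nlinarith
  have hz2 := one_sub_normSq_pos hz1
  calc (1 - r ^ 2) * (1 - ‖w‖ ^ 2) * ‖1 - z * conj w‖ ^ 2
      ≤ (4 * (1 - ‖z‖ ^ 2)) * (1 - ‖w‖ ^ 2) * (9 / 4 * ‖1 - r * e * conj w‖ ^ 2) := by gcongr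
    _ = _ := by ring

theorem lintegralV_le_nine_mul (μ : Measure ℂ) {e : ℂ} (he : ‖e‖ = 1) {r : ℝ} (hr : 0 < r)
    (hr1 : r < 1) {z : ℂ} (hz : ‖z - r * e‖ < (1 - r) / 2) :
    lintegralV μ (r * e) ≤ 9 * lintegralV μ z := by
  rw [lintegralV, lintegralV, ← lintegral_const_mul' _ _ (by simp)]
  refine setLIntegral_mono' measurableSet_disc fun w hw => ?_
  rw [← ENNReal.ofReal_ofNat, ← ENNReal.ofReal_mul (by norm_num)]
  exact ENNReal.ofReal_le_ofReal (berezinKernel_le_nine_mul he hr hr1 hz hw)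

/-- The area submean value property of `|h|²`. -/
theorem norm_sq_mul_le_lintegral_ball {h : ℂ → ℂ} {c : ℂ} {R : ℝ} (hR : 0 < R)
    (hh : DifferentiableOn ℂ h (Metric.ball c R)) :
    ‖h c‖ₑ ^ 2 * ENNReal.ofReal (R ^ 2) ≤
      (ENNReal.ofReal Real.pi)⁻¹ * ∫⁻ z in Metric.ball c R, ‖h z‖ₑ ^ 2 := by
  have himg : (fun ζ : ℂ => c + R * ζ) '' disc = Metric.ball c R := by
    ext z
    constructor
    · rintro ⟨ζ, hζ, rfl⟩
      rw [mem_disc] at hζ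
      simp only [mem_ball_iff_norm, add_sub_cancel_left, norm_mul, Complex.norm_real,
        Real.norm_of_nonneg hR.le]
      nlinarith
    · intro hz
      have hR' : (R : ℂ) ≠ 0 := by exact_mod_cast hR.ne'
      refine ⟨(z - c) / R, ?_, by field_simp; ring⟩
      rw [mem_disc, norm_div, Complex.norm_real, Real.norm_of_nonneg hR.le, div_lt_one hR]
      exact mem_ball_iff_norm.1 hz
  have hinj : InjOn (fun ζ : ℂ => c + R * ζ) disc := fun x _ y _ hxy => by
    have hR' : (R : ℂ) ≠ 0 := by exact_mod_cast hR.ne'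
    simpa [hR'] using hxy
  have hder : ∀ ζ ∈ disc, HasDerivAt (fun ζ : ℂ => c + R * ζ) R ζ := fun ζ _ => by
    simpa using ((hasDerivAt_id ζ).const_mul (R : ℂ)).const_add c
  have hd : DifferentiableOn ℂ (fun ζ => h (c + R * ζ)) disc :=
    hh.comp (by fun_prop) (fun ζ hζ => himg ▸ mem_image_of_mem _ hζ)
  have hP := lintegral_areaMeasure_norm_sq_mul_radial (ρ := fun _ => 1) hd.continuousOn
    (fun z hz => hasSum_taylorCoeff hd hz) measurable_const
  -- In the expansion of the area integral over the unit disc, the term n = 0 alone is |h(c)|².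
  have h0 : ‖h c‖ₑ ^ 2 ≤ ∫⁻ z, ‖h (c + R * z)‖ₑ ^ 2 * 1 ∂areaMeasure := by
    rw [hP]
    refine le_trans (le_of_eq ?_) (ENNReal.le_tsum 0)
    have e : 2 * ∫⁻ r in Ioo (0 : ℝ) 1, ENNReal.ofReal (r ^ (2 * 0 + 1)) * 1 = 1 := by
      simp only [mul_one, mul_zero, zero_add, pow_one]
      rw [← ofReal_integral_eq_lintegral_ofReal, ← integral_Ioc_eq_integral_Ioo,
        ← intervalIntegral.integral_of_le zero_le_one, integral_id, ← ENNReal.ofReal_ofNat,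
        ← ENNReal.ofReal_mul zero_le_two]
      · norm_num
      · exact (continuous_id.continuousOn.integrableOn_compact isCompact_Icc).mono_set
          Ioo_subset_Icc_self
      · exact (ae_restrict_iff' measurableSet_Ioo).2 (Filter.Eventually.of_forall fun r hr => hr.1.le)
    rw [e, mul_one, taylorCoeff_zero]
    simp
  rw [← himg, lintegral_image_eq_lintegral_norm_deriv_sq measurableSet_disc hder hinj,
    lintegral_const_mul' _ _ (ENNReal.pow_ne_top enorm_ne_top)]
  rw [lintegral_areaMeasure] at h0
  simp only [mul_one] at h0
  have eR : ‖(R : ℂ)‖ₑ ^ 2 = ENNReal.ofReal (R ^ 2) := by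
    rw [← ofReal_norm, Complex.norm_real, Real.norm_of_nonneg hR.le, ENNReal.ofReal_pow hR.le]
  rw [eR, mul_left_comm, mul_comm]
  gcongr

/-- If z lies in the disc about re and d = 1 - |z|, then 2d/3 < 1 - r < 2d. So the integrand is at
most 54/d on an interval of length 4d/3. The 36 is 4 · 9: the squared radius ((1-r)/2)² gives the 4,
the Harnack constant the 9. -/
theorem lintegral_inv_one_sub_ball_le {e : ℂ} (he : ‖e‖ = 1) {z : ℂ} (hz : z ∈ disc) :
    ∫⁻ r in Ioo (0 : ℝ) 1, {r : ℝ | ‖z - r * e‖ < (1 - r) / 2}.indicator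
      (fun r => ENNReal.ofReal (36 / (1 - r))) r ≤ 72 := by
  set d := 1 - ‖z‖ with hd
  have hd0 : 0 < d := by have := mem_disc.1 hz; linarith
  calc _ ≤ ∫⁻ r in Ioo (0 : ℝ) 1, (Ioo (1 - 2 * d) (1 - 2 / 3 * d)).indicator
          (fun _ => ENNReal.ofReal (54 / d)) r := by
        refine setLIntegral_mono' measurableSet_Ioo fun r hr => ?_
        by_cases h : ‖z - r * e‖ < (1 - r) / 2
        · have hre : ‖(r : ℂ) * e‖ = r := by
            rw [norm_mul, he, Complex.norm_real, Real.norm_of_nonneg hr.1.le, mul_one]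
          have h1 := norm_sub_norm_le z (r * e)
          have h2 := norm_sub_norm_le (r * e) z
          rw [norm_sub_rev, hre] at h2
          rw [hre] at h1
          have h3 : r ∈ Ioo (1 - 2 * d) (1 - 2 / 3 * d) := ⟨by linarith, by linarith⟩
          rw [indicator_of_mem (by exact h), indicator_of_mem h3]
          refine ENNReal.ofReal_le_ofReal ?_
          have : 0 < 1 - r := by linarith [hr.2]
          rw [div_le_div_iff₀ this hd0]
          linarith [h3.2]
        · rw [indicator_of_notMem (by exact h)]
          exact zero_le
    _ ≤ ∫⁻ r : ℝ, (Ioo (1 - 2 * d) (1 - 2 / 3 * d)).indicator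
          (fun _ => ENNReal.ofReal (54 / d)) r := setLIntegral_le_lintegral _ _
    _ = 72 := by
        rw [lintegral_indicator measurableSet_Ioo, lintegral_const, Measure.restrict_apply_univ,
          Real.volume_Ioo, ← ENNReal.ofReal_mul (by positivity)]
        have : 54 / d * (1 - 2 / 3 * d - (1 - 2 * d)) = 72 := by field_simp; ring
        rw [this, ENNReal.ofReal_ofNat]

/-- The integral of `|h|²` along a radius against a weight that is almost constant on hyperbolic
discs is dominated by the corresponding area integral. -/
theorem lintegral_radius_le {h : ℂ → ℂ} (hh : DifferentiableOn ℂ h disc) {e : ℂ} (he : ‖e‖ = 1)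
    {W : ℂ → ℝ≥0∞} (hW : Measurable W)
    (hdbl : ∀ r : ℝ, 0 < r → r < 1 → ∀ z, ‖z - r * e‖ < (1 - r) / 2 → W (r * e) ≤ 9 * W z) :
    ∫⁻ r in Ioo (0 : ℝ) 1, ‖h (r * e)‖ₑ ^ 2 * (ENNReal.ofReal (1 - r) * W (r * e)) ≤
      72 * ∫⁻ z, ‖h z‖ₑ ^ 2 * W z ∂areaMeasure := by
  have hmeas : Measurable (disc.indicator h) := by
    classical
    have := hh.continuousOn.measurable_piecewise (g := fun _ => (0 : ℂ)) continuousOn_const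
      measurableSet_disc
    exact (piecewise_eq_indicator (f := h) (s := disc)) ▸ this
  set g : ℂ → ℝ≥0∞ := fun z => ‖disc.indicator h z‖ₑ ^ 2 * W z with hg
  have hgm : Measurable g := by fun_prop
  set S : Set (ℝ × ℂ) := {p | ‖p.2 - p.1 * e‖ < (1 - p.1) / 2} with hS
  have hSm : MeasurableSet S := measurableSet_lt (by fun_prop) (by fun_prop)
  set H : ℝ × ℂ → ℝ≥0∞ := S.indicator (fun p => ENNReal.ofReal (36 / (1 - p.1))) with hH
  have hHm : Measurable H := Measurable.indicator (by fun_prop) hSm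
  have step : ∀ r ∈ Ioo (0 : ℝ) 1, ‖h (r * e)‖ₑ ^ 2 * (ENNReal.ofReal (1 - r) * W (r * e)) ≤
      ∫⁻ z, H (r, z) * g z ∂areaMeasure := by
    intro r hr
    have hr1 : 0 < 1 - r := by linarith [hr.2]
    have hsub : Metric.ball ((r : ℂ) * e) ((1 - r) / 2) ⊆ disc := fun z hz => by
      have := mem_ball_iff_norm.1 hz
      have h1 := norm_sub_norm_le z (r * e)
      rw [norm_mul, he, Complex.norm_real, Real.norm_of_nonneg hr.1.le] at h1
      rw [mem_disc]; linarith
    have h1 := norm_sq_mul_le_lintegral_ball (half_pos hr1) (hh.mono hsub)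
    -- Splits off the squared radius required by the submean value inequality, leaving the
    -- scale-invariant density 4/(1-r).
    have e1 : ENNReal.ofReal (1 - r) =
        ENNReal.ofReal (((1 - r) / 2) ^ 2) * ENNReal.ofReal (4 / (1 - r)) := by
      rw [← ENNReal.ofReal_mul (by positivity)]; congr 1; field_simp; ring
    rw [lintegral_areaMeasure]
    calc ‖h (r * e)‖ₑ ^ 2 * (ENNReal.ofReal (1 - r) * W (r * e))
        = (‖h (r * e)‖ₑ ^ 2 * ENNReal.ofReal (((1 - r) / 2) ^ 2)) *
            (ENNReal.ofReal (4 / (1 - r)) * W (r * e)) := by rw [e1]; ring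
      _ ≤ ((ENNReal.ofReal Real.pi)⁻¹ *
            ∫⁻ z in Metric.ball ((r : ℂ) * e) ((1 - r) / 2), ‖h z‖ₑ ^ 2) *
            (ENNReal.ofReal (4 / (1 - r)) * W (r * e)) := by gcongr
      _ = (ENNReal.ofReal Real.pi)⁻¹ *
            ∫⁻ z in Metric.ball ((r : ℂ) * e) ((1 - r) / 2),
              ‖h z‖ₑ ^ 2 * (ENNReal.ofReal (4 / (1 - r)) * W (r * e)) := by
          rw [lintegral_mul_const'', mul_assoc]
          exact ((hh.mono hsub).continuousOn.aestronglyMeasurable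
            Metric.isOpen_ball.measurableSet).enorm.pow_const 2
      _ ≤ (ENNReal.ofReal Real.pi)⁻¹ *
            ∫⁻ z in Metric.ball ((r : ℂ) * e) ((1 - r) / 2), H (r, z) * g z := by
          gcongr _ * ?_
          refine setLIntegral_mono' Metric.isOpen_ball.measurableSet fun z hz => ?_
          have hz' : ‖z - r * e‖ < (1 - r) / 2 := mem_ball_iff_norm.1 hz
          have hzS : (r, z) ∈ S := hz'
          rw [hH, indicator_of_mem hzS, hg]
          simp only [indicator_of_mem (hsub hz)]
          calc ‖h z‖ₑ ^ 2 * (ENNReal.ofReal (4 / (1 - r)) * W (r * e))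
              ≤ ‖h z‖ₑ ^ 2 * (ENNReal.ofReal (4 / (1 - r)) * (9 * W z)) := by
                gcongr; exact hdbl r hr.1 hr.2 z hz'
            _ = ENNReal.ofReal (36 / (1 - r)) * (‖h z‖ₑ ^ 2 * W z) := by
                have : ENNReal.ofReal (36 / (1 - r)) = ENNReal.ofReal (4 / (1 - r)) * 9 := by
                  rw [← ENNReal.ofReal_ofNat 9, ← ENNReal.ofReal_mul (by positivity)]
                  congr 1; ring
                rw [this]; ring
      _ ≤ (ENNReal.ofReal Real.pi)⁻¹ * ∫⁻ z in disc, H (r, z) * g z := by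
          gcongr _ * ?_
          exact lintegral_mono_set hsub
  have : SFinite areaMeasure := by unfold areaMeasure; infer_instance
  calc _ ≤ ∫⁻ r in Ioo (0 : ℝ) 1, ∫⁻ z, H (r, z) * g z ∂areaMeasure :=
        setLIntegral_mono' measurableSet_Ioo step
    _ = ∫⁻ z, (∫⁻ r in Ioo (0 : ℝ) 1, H (r, z)) * g z ∂areaMeasure := by
        rw [lintegral_lintegral_swap]
        · congr 1; ext z
          rw [lintegral_mul_const]
          exact hHm.comp (by fun_prop)
        · exact (hHm.mul (hgm.comp measurable_snd)).aemeasurable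
    _ ≤ ∫⁻ z, 72 * (‖h z‖ₑ ^ 2 * W z) ∂areaMeasure := by
        rw [lintegral_areaMeasure, lintegral_areaMeasure]
        gcongr _ * ?_
        refine setLIntegral_mono' measurableSet_disc fun z hz => ?_
        simp only [hg, indicator_of_mem hz]
        gcongr
        exact lintegral_inv_one_sub_ball_le he hz
    _ = _ := lintegral_const_mul' _ _ (by simp)

/-! ### The radial weight and the size function. -/

/-- The denominator `(1 - r) V_μ(r e) + (1 - r)²`. -/
noncomputable def radialWeight (μ : Measure ℂ) (e : ℂ) (r : ℝ) : ℝ :=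
  (1 - r) * (lintegralV μ (r * e)).toReal + (1 - r) ^ 2

theorem measurable_radialWeight (μ : Measure ℂ) [SFinite (μ.restrict disc)] (e : ℂ) :
    Measurable (radialWeight μ e) := by
  have h : Measurable fun r : ℝ => lintegralV μ (r * e) :=
    (measurable_lintegralV μ).comp (by fun_prop)
  unfold radialWeight
  fun_prop

theorem sq_le_radialWeight (μ : Measure ℂ) (e : ℂ) {r : ℝ} (hr : r ≤ 1) :
    (1 - r) ^ 2 ≤ radialWeight μ e r :=
  le_add_of_nonneg_left (mul_nonneg (by linarith) ENNReal.toReal_nonneg)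

theorem radialWeight_pos (μ : Measure ℂ) (e : ℂ) {r : ℝ} (hr : r < 1) : 0 < radialWeight μ e r :=
  lt_of_lt_of_le (by have : 0 < 1 - r := by linarith
                     positivity) (sq_le_radialWeight μ e hr.le)

/-- The integral in `kernelSize`, with values in `[0, ∞]`. -/
noncomputable def radialSize (μ : Measure ℂ) (e : ℂ) (ρ : ℝ) : ℝ≥0∞ :=
  ∫⁻ r in Ioo 0 ρ, ENNReal.ofReal (1 / radialWeight μ e r)

theorem norm_div_norm {z : ℂ} (hz : z ≠ 0) : ‖z / (‖z‖ : ℂ)‖ = 1 := by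
  rw [norm_div, Complex.norm_real, norm_norm, div_self (norm_ne_zero_iff.2 hz)]

theorem one_div_radialWeight_le (μ : Measure ℂ) (e : ℂ) {r ρ : ℝ} (hρ : ρ < 1) (hr : r ≤ ρ) :
    1 / radialWeight μ e r ≤ 1 / (1 - ρ) ^ 2 := by
  have h1 : 0 < 1 - ρ := by linarith
  refine one_div_le_one_div_of_le (by positivity)
    (le_trans ?_ (sq_le_radialWeight μ e (by linarith)))
  gcongr

theorem integrableOn_one_div_radialWeight (μ : Measure ℂ) [SFinite (μ.restrict disc)] (e : ℂ)
    {ρ : ℝ} (hρ : ρ < 1) : IntegrableOn (fun r => 1 / radialWeight μ e r) (Ioc 0 ρ) := by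
  have hm := measurable_radialWeight μ e
  have : IsFiniteMeasure (volume.restrict (Ioc 0 ρ)) := ⟨by simp⟩
  refine Integrable.of_bound (C := 1 / (1 - ρ) ^ 2)
    (by fun_prop : Measurable fun r => 1 / radialWeight μ e r).aestronglyMeasurable
    ((ae_restrict_iff' measurableSet_Ioc).2 (Filter.Eventually.of_forall fun r hr => ?_))
  rw [Real.norm_of_nonneg (one_div_nonneg.2 (radialWeight_pos μ e (by linarith [hr.2])).le)]
  exact one_div_radialWeight_le μ e hρ hr.2

theorem kernelSize_eq (μ : Measure ℂ) {z : ℂ} (hz : z ∈ disc) (hz0 : z ≠ 0) :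
    kernelSize μ z = 1 + ∫ r in Ioc 0 ‖z‖, 1 / radialWeight μ (z / (‖z‖ : ℂ)) r := by
  rw [kernelSize, intervalIntegral.integral_of_le (norm_nonneg z)]
  congr 1
  refine setIntegral_congr_fun measurableSet_Ioc fun r hr => ?_
  have hd : (r : ℂ) * (z / (‖z‖ : ℂ)) ∈ disc :=
    ofReal_mul_mem_disc (norm_div_norm hz0) hr.1.le (by linarith [hr.2, mem_disc.1 hz])
  simp only [radialWeight]
  rw [mul_div_assoc, V_eq_toReal hd]

theorem ofReal_kernelSize {μ : Measure ℂ} [SFinite (μ.restrict disc)] {z : ℂ} (hz : z ∈ disc)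
    (hz0 : z ≠ 0) :
    ENNReal.ofReal (kernelSize μ z) = 1 + radialSize μ (z / (‖z‖ : ℂ)) ‖z‖ := by
  have hnn : ∀ᵐ r ∂volume.restrict (Ioc 0 ‖z‖), 0 ≤ 1 / radialWeight μ (z / (‖z‖ : ℂ)) r :=
    (ae_restrict_iff' measurableSet_Ioc).2 (Filter.Eventually.of_forall fun r hr =>
      one_div_nonneg.2 (radialWeight_pos μ _ (by linarith [hr.2, mem_disc.1 hz])).le)
  rw [kernelSize_eq μ hz hz0, ENNReal.ofReal_add zero_le_one (integral_nonneg_of_ae hnn),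
    ENNReal.ofReal_one, ofReal_integral_eq_lintegral_ofReal
      (integrableOn_one_div_radialWeight μ _ (mem_disc.1 hz)) hnn, radialSize,
    restrict_Ioo_eq_restrict_Ioc]

/-! ### The pointwise upper estimate. -/

/-- The square of the norm of `D_ω`, with values in `[0, ∞]`. -/
noncomputable def dirichletNormSq (ω : ℂ → ℝ≥0∞) (f : ℂ → ℂ) : ℝ≥0∞ :=
  ∑' n, ‖taylorCoeff f n‖ₑ ^ 2 + dirichletIntegral ω f

theorem aestronglyMeasurable_areaMeasure {h : ℂ → ℂ} (hc : ContinuousOn h disc) :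
    AEStronglyMeasurable h areaMeasure :=
  AEStronglyMeasurable.smul_measure (hc.aestronglyMeasurable measurableSet_disc) _

/-- Cauchy–Schwarz for F√ψ and 1/√ψ. -/
theorem sq_lintegral_le_mul {α : Type*} [MeasurableSpace α] {m : Measure α} {F : α → ℝ≥0∞}
    {ψ : α → ℝ} (hF : AEMeasurable F m) (hψ : AEMeasurable ψ m) (hpos : ∀ᵐ x ∂m, 0 < ψ x) :
    (∫⁻ x, F x ∂m) ^ 2 ≤
      (∫⁻ x, F x ^ 2 * ENNReal.ofReal (ψ x) ∂m) * ∫⁻ x, ENNReal.ofReal (1 / ψ x) ∂m := by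
  have h := ENNReal.lintegral_mul_le_Lp_mul_Lq m Real.HolderConjugate.two_two
    (f := fun x => F x * ENNReal.ofReal (√(ψ x))) (g := fun x => ENNReal.ofReal (1 / √(ψ x)))
    (by fun_prop) (by fun_prop)
  have e1 : ∫⁻ x, F x ∂m = ∫⁻ x, ((fun x => F x * ENNReal.ofReal (√(ψ x))) *
      fun x => ENNReal.ofReal (1 / √(ψ x))) x ∂m := by
    refine lintegral_congr_ae (hpos.mono fun x hx => ?_)
    have := Real.sqrt_pos.2 hx
    simp only [Pi.mul_apply]
    rw [mul_assoc, ← ENNReal.ofReal_mul this.le, mul_one_div_cancel this.ne', ENNReal.ofReal_one,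
      mul_one]
  have e2 : ∫⁻ x, F x ^ 2 * ENNReal.ofReal (ψ x) ∂m =
      ∫⁻ x, (F x * ENNReal.ofReal (√(ψ x))) ^ (2 : ℝ) ∂m := by
    refine lintegral_congr_ae (hpos.mono fun x hx => ?_)
    simp only [ENNReal.rpow_two]
    rw [mul_pow, ← ENNReal.ofReal_pow (Real.sqrt_nonneg _), Real.sq_sqrt hx.le]
  have e3 : ∫⁻ x, ENNReal.ofReal (1 / ψ x) ∂m =
      ∫⁻ x, ENNReal.ofReal (1 / √(ψ x)) ^ (2 : ℝ) ∂m := by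
    refine lintegral_congr_ae (hpos.mono fun x hx => ?_)
    simp only [ENNReal.rpow_two]
    rw [← ENNReal.ofReal_pow (by positivity), div_pow, Real.sq_sqrt hx.le, one_pow]
  rw [e1, e2, e3]
  calc _ ≤ _ := pow_le_pow_left' h 2
    _ = _ := by
      rw [mul_pow, ← ENNReal.rpow_two, ← ENNReal.rpow_two, ← ENNReal.rpow_mul, ← ENNReal.rpow_mul]
      norm_num

theorem enorm_sub_le_lintegral_radius {f : ℂ → ℂ} (hf : DifferentiableOn ℂ f disc) {e : ℂ}
    (he : ‖e‖ = 1) {ρ : ℝ} (hρ0 : 0 ≤ ρ) (hρ : ρ < 1) :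
    ‖f (ρ * e) - f 0‖ₑ ≤ ∫⁻ r in Ioo 0 ρ, ‖deriv f (r * e)‖ₑ := by
  have hmem : ∀ r ∈ Icc 0 ρ, (r : ℂ) * e ∈ disc := fun r hr =>
    ofReal_mul_mem_disc he hr.1 (by linarith [hr.2])
  have hc : ContinuousOn (fun r : ℝ => deriv f (r * e) * e) (Icc 0 ρ) :=
    ((differentiableOn_deriv hf).continuousOn.comp (by fun_prop) hmem).mul continuousOn_const
  have hd : ∀ r ∈ uIcc 0 ρ, HasDerivAt (fun r : ℝ => f (r * e)) (deriv f (r * e) * e) r := by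
    intro r hr
    rw [uIcc_of_le hρ0] at hr
    have h1 := ((hf _ (hmem r hr)).differentiableAt
      (isOpen_disc.mem_nhds (hmem r hr))).hasDerivAt
    have h2 : HasDerivAt (fun r : ℝ => (r : ℂ) * e) e r := by
      simpa using (Complex.ofRealCLM.hasDerivAt (x := r)).mul_const e
    exact h1.comp r h2
  have h := intervalIntegral.integral_eq_sub_of_hasDerivAt hd
    (by rw [← uIcc_of_le hρ0] at hc; exact hc.intervalIntegrable)
  simp only [Complex.ofReal_zero, zero_mul] at h
  rw [← h, intervalIntegral.integral_of_le hρ0, integral_Ioc_eq_integral_Ioo]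
  refine (enorm_integral_le_lintegral_enorm _).trans (le_of_eq ?_)
  congr 1; ext r
  rw [enorm_mul, ← ofReal_norm e, he, ENNReal.ofReal_one, mul_one]

/-- The radial weight is at most (1-r)W(re) with W = 1 - |z|² + V_μ. After passing to area
integrals, the first summand of W is absorbed by the Hardy norm and the second by the Dirichlet
integral, through V_μ ≤ 2ω. -/
theorem lintegral_deriv_sq_mul_radialWeight_le {ω : ℂ → ℝ≥0∞} {μ : Measure ℂ}
    (hω : IsPureSuperharmonicWeight ω μ) {f : ℂ → ℂ} (hf : DifferentiableOn ℂ f disc) {e : ℂ}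
    (he : ‖e‖ = 1) :
    ∫⁻ r in Ioo (0 : ℝ) 1, ‖deriv f (r * e)‖ₑ ^ 2 * ENNReal.ofReal (radialWeight μ e r) ≤
      144 * dirichletNormSq ω f := by
  have := sFinite_restrict_disc hω.riesz_finite
  have hV := measurable_lintegralV μ
  set W : ℂ → ℝ≥0∞ := fun z => ENNReal.ofReal (1 - ‖z‖ ^ 2) + lintegralV μ z with hW
  have hWm : Measurable W := by fun_prop
  have hdbl : ∀ r : ℝ, 0 < r → r < 1 → ∀ z, ‖z - r * e‖ < (1 - r) / 2 →
      W (r * e) ≤ 9 * W z := by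
    intro r hr hr1 z hz
    simp only [hW, mul_add]
    refine add_le_add ?_ (lintegralV_le_nine_mul μ he hr hr1 hz)
    -- At w = 0 the kernel of V_μ is 1 - |z|², so the same Harnack bound covers this summand.
    have h0 : (0 : ℂ) ∈ disc := by simp [mem_disc]
    have := berezinKernel_le_nine_mul he hr hr1 hz h0
    simp only [berezinKernel, norm_zero, map_zero, mul_zero, sub_zero, norm_one] at this
    rw [← ENNReal.ofReal_ofNat, ← ENNReal.ofReal_mul (by norm_num)]
    exact ENNReal.ofReal_le_ofReal (by simpa using this)
  calc _ ≤ ∫⁻ r in Ioo (0 : ℝ) 1, ‖deriv f (r * e)‖ₑ ^ 2 *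
          (ENNReal.ofReal (1 - r) * W (r * e)) := by
        refine setLIntegral_mono' measurableSet_Ioo fun r hr => ?_
        gcongr
        have hr1 : 0 < 1 - r := by linarith [hr.2]
        have hd := ofReal_mul_mem_disc he hr.1.le hr.2
        rw [radialWeight, hW, ENNReal.ofReal_add (mul_nonneg hr1.le ENNReal.toReal_nonneg)
          (by positivity), ENNReal.ofReal_mul hr1.le,
          ENNReal.ofReal_toReal (lintegralV_lt_top hω.riesz_finite hd).ne, mul_add, add_comm,
          sq, ENNReal.ofReal_mul hr1.le]
        gcongr
        rw [norm_mul, he, Complex.norm_real, Real.norm_of_nonneg hr.1.le]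
        nlinarith [hr.1, hr.2]
    _ ≤ 72 * ∫⁻ z, ‖deriv f z‖ₑ ^ 2 * W z ∂areaMeasure :=
        lintegral_radius_le (differentiableOn_deriv hf) he hWm hdbl
    _ ≤ 72 * (∑' n, ‖taylorCoeff f n‖ₑ ^ 2 + 2 * dirichletIntegral ω f) := by
        gcongr
        simp only [hW, mul_add]
        have hmf : AEMeasurable (fun z => ‖deriv f z‖ₑ ^ 2 * ENNReal.ofReal (1 - ‖z‖ ^ 2))
            areaMeasure := by
          have h1 := (aestronglyMeasurable_areaMeasure
            (differentiableOn_deriv hf).continuousOn).enorm.pow_const 2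
          have h2 : Measurable fun z : ℂ => ENNReal.ofReal (1 - ‖z‖ ^ 2) := by fun_prop
          exact h1.mul h2.aemeasurable
        rw [lintegral_add_left' hmf]
        refine add_le_add (lintegral_deriv_sq_mul_one_sub_sq_le hf) ?_
        rw [dirichletIntegral, ← lintegral_const_mul' _ _ (by simp), lintegral_areaMeasure,
          lintegral_areaMeasure]
        gcongr _ * ?_
        refine setLIntegral_mono' measurableSet_disc fun z hz => ?_
        rw [hω.eq_green z hz, mul_left_comm]
        gcongr
        exact lintegralV_le_two_mul_greenPotential μ hz
    _ ≤ 144 * dirichletNormSq ω f := by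
        rw [dirichletNormSq, (by norm_num : (144 : ℝ≥0∞) = 72 * 2), mul_assoc, mul_add 2]
        gcongr
        rw [two_mul]; exact le_self_add

theorem enorm_sq_add_le (a b : ℂ) : ‖a + b‖ₑ ^ 2 ≤ 2 * ‖a‖ₑ ^ 2 + 2 * ‖b‖ₑ ^ 2 := by
  simp only [← ofReal_norm, ← ENNReal.ofReal_pow (norm_nonneg _)]
  rw [← ENNReal.ofReal_ofNat, ← ENNReal.ofReal_mul zero_le_two, ← ENNReal.ofReal_mul zero_le_two,
    ← ENNReal.ofReal_add (by positivity) (by positivity)]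
  refine ENNReal.ofReal_le_ofReal ?_
  have := norm_add_le a b
  nlinarith [norm_nonneg (a + b), norm_nonneg a, norm_nonneg b, sq_nonneg (‖a‖ - ‖b‖)]

/-- Pointwise estimate for functions of `D_ω`. -/
theorem enorm_sq_le_kernelSize_mul {ω : ℂ → ℝ≥0∞} {μ : Measure ℂ}
    (hω : IsPureSuperharmonicWeight ω μ) {f : ℂ → ℂ} (hf : DifferentiableOn ℂ f disc) {z : ℂ}
    (hz : z ∈ disc) (hz0 : z ≠ 0) :
    ‖f z‖ₑ ^ 2 ≤ 288 * ENNReal.ofReal (kernelSize μ z) * dirichletNormSq ω f := by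
  have := sFinite_restrict_disc hω.riesz_finite
  set e : ℂ := z / (‖z‖ : ℂ) with hedef
  have he : ‖e‖ = 1 := norm_div_norm hz0
  have hz1 := mem_disc.1 hz
  have hze : (‖z‖ : ℂ) * e = z := by
    have : (‖z‖ : ℂ) ≠ 0 := by exact_mod_cast norm_ne_zero_iff.2 hz0
    rw [hedef]; field_simp
  have h1 := enorm_sub_le_lintegral_radius hf he (norm_nonneg z) hz1
  rw [hze] at h1
  have hmem : ∀ r ∈ Ioo 0 ‖z‖, (r : ℂ) * e ∈ disc := fun r hr =>
    ofReal_mul_mem_disc he hr.1.le (by linarith [hr.2])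
  have hc : ContinuousOn (fun r : ℝ => deriv f (r * e)) (Ioo 0 ‖z‖) :=
    (differentiableOn_deriv hf).continuousOn.comp (by fun_prop) hmem
  have h2 := sq_lintegral_le_mul (m := volume.restrict (Ioo 0 ‖z‖))
    (F := fun r : ℝ => ‖deriv f (r * e)‖ₑ) (ψ := radialWeight μ e)
    (hc.aestronglyMeasurable measurableSet_Ioo).enorm
    (measurable_radialWeight μ e).aemeasurable
    ((ae_restrict_iff' measurableSet_Ioo).2 (Filter.Eventually.of_forall fun r hr =>
      radialWeight_pos μ e (by linarith [hr.2])))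
  have h3 : ∫⁻ r in Ioo 0 ‖z‖, ‖deriv f (r * e)‖ₑ ^ 2 * ENNReal.ofReal (radialWeight μ e r) ≤
      144 * dirichletNormSq ω f :=
    (lintegral_mono_set (Ioo_subset_Ioo_right hz1.le)).trans
      (lintegral_deriv_sq_mul_radialWeight_le hω hf he)
  have h4 : ‖f 0‖ₑ ^ 2 ≤ dirichletNormSq ω f := by
    rw [dirichletNormSq, ← taylorCoeff_zero f]
    exact (ENNReal.le_tsum (f := fun n => ‖taylorCoeff f n‖ₑ ^ 2) 0).trans le_self_add
  rw [ofReal_kernelSize hz hz0]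
  calc ‖f z‖ₑ ^ 2 = ‖f 0 + (f z - f 0)‖ₑ ^ 2 := by rw [add_sub_cancel]
    _ ≤ 2 * ‖f 0‖ₑ ^ 2 + 2 * ‖f z - f 0‖ₑ ^ 2 := enorm_sq_add_le _ _
    _ ≤ 2 * dirichletNormSq ω f +
          2 * (144 * dirichletNormSq ω f * radialSize μ e ‖z‖) := by
        gcongr
        exact (pow_le_pow_left' h1 2).trans (h2.trans (mul_le_mul_left h3 _))
    _ ≤ 288 * dirichletNormSq ω f + 288 * (dirichletNormSq ω f * radialSize μ e ‖z‖) := by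
        refine add_le_add (mul_le_mul_left (by norm_num) _) (le_of_eq ?_)
        rw [mul_assoc, ← mul_assoc]; norm_num
    _ = 288 * (1 + radialSize μ e ‖z‖) * dirichletNormSq ω f := by ring

/-! ### A Hilbert-type inequality by Schur's test. -/

theorem lintegral_deriv_of_nonneg {G G' : ℝ → ℝ} {a b : ℝ} (hab : a ≤ b)
    (hc : ContinuousOn G (Icc a b)) (hd : ∀ x ∈ Ioo a b, HasDerivAt G (G' x) x)
    (hn : ∀ x ∈ Ioo a b, 0 ≤ G' x) :
    ∫⁻ x in Ioo a b, ENNReal.ofReal (G' x) = ENNReal.ofReal (G b - G a) := by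
  have hint := intervalIntegral.integrableOn_deriv_of_nonneg hc hd hn
  rw [← ofReal_integral_eq_lintegral_ofReal (hint.mono_set Ioo_subset_Ioc_self)
    ((ae_restrict_iff' measurableSet_Ioo).2 (Filter.Eventually.of_forall hn)),
    ← integral_Ioc_eq_integral_Ioo, ← intervalIntegral.integral_of_le hab,
    intervalIntegral.integral_eq_sub_of_hasDerivAt_of_le hab hc hd
      ((intervalIntegrable_iff_integrableOn_Ioc_of_le hab).2 hint)]

/-- Schur's test with weight √(1-x). The denominator 1 - xy is at least 1 - y for y < x and at least
1 - x for y > x; each half then has an explicit primitive and contributes at most 2. -/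
theorem lintegral_schur_le {x : ℝ} (hx : x ∈ Ioo (0 : ℝ) 1) :
    ∫⁻ y in Ioo (0 : ℝ) 1, ENNReal.ofReal (√(1 - x) / √(1 - y) * (1 / (1 - x * y))) ≤ 4 := by
  obtain ⟨hx0, hx1⟩ := hx
  have hs : 0 < 1 - x := by linarith
  have hss := Real.sqrt_pos.2 hs
  have e : Ioo (0 : ℝ) 1 ⊆ Ioo 0 x ∪ Icc x x ∪ Ioo x 1 := by
    intro y hy
    rcases lt_trichotomy y x with h | h | h
    · exact Or.inl (Or.inl ⟨hy.1, h⟩)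
    · exact Or.inl (Or.inr ⟨h.ge, h.le⟩)
    · exact Or.inr ⟨h, hy.2⟩
  have h1 : ∫⁻ y in Ioo 0 x, ENNReal.ofReal (√(1 - x) / √(1 - y) * (1 / (1 - x * y))) ≤ 2 := by
    have hF := lintegral_deriv_of_nonneg (a := 0) (b := x) (G := fun y => 2 * √(1 - x) / √(1 - y))
      (G' := fun y => √(1 - x) / √(1 - y) * (1 / (1 - y))) hx0.le
      (by refine continuousOn_const.div (by fun_prop) fun y hy => ?_
          exact (Real.sqrt_pos.2 (by linarith [hy.2])).ne')
      (fun y hy => by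
        have ht : 0 < 1 - y := by linarith [hy.2]
        have hst := Real.sqrt_pos.2 ht
        have h := (hasDerivAt_const y (2 * √(1 - x))).div
          (((hasDerivAt_id y).const_sub 1).sqrt ht.ne') hst.ne'
        refine h.congr_deriv ?_
        simp only [id, zero_mul, zero_sub, Real.sq_sqrt ht.le]
        field_simp)
      (fun y hy => by
        have ht : 0 < 1 - y := by linarith [hy.2]
        positivity)
    calc _ ≤ _ := setLIntegral_mono' measurableSet_Ioo fun y hy => by
          refine ENNReal.ofReal_le_ofReal (mul_le_mul_of_nonneg_left ?_ (by positivity))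
          refine one_div_le_one_div_of_le (by linarith [hy.2]) (by nlinarith [hy.1, hy.2])
      _ = _ := hF
      _ ≤ 2 := by
          rw [← ENNReal.ofReal_ofNat]
          refine ENNReal.ofReal_le_ofReal ?_
          simp only [sub_zero, Real.sqrt_one, div_one]
          rw [mul_div_assoc, div_self hss.ne']; linarith
  have h2 : ∫⁻ y in Ioo x 1, ENNReal.ofReal (√(1 - x) / √(1 - y) * (1 / (1 - x * y))) ≤ 2 := by
    have hF := lintegral_deriv_of_nonneg (a := x) (b := 1)
      (G := fun y => -(2 * √(1 - y)) / √(1 - x))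
      (G' := fun y => √(1 - x) / √(1 - y) * (1 / (1 - x))) hx1.le
      (by fun_prop)
      (fun y hy => by
        have ht : 0 < 1 - y := by linarith [hy.2]
        have hst := Real.sqrt_pos.2 ht
        have h := (((((hasDerivAt_id y).const_sub 1).sqrt ht.ne').const_mul 2).neg).div_const
          (√(1 - x))
        refine h.congr_deriv ?_
        simp only [id]
        field_simp
        rw [Real.sq_sqrt hs.le])
      (fun y hy => by
        have ht : 0 < 1 - y := by linarith [hy.2]
        positivity)
    calc _ ≤ _ := setLIntegral_mono' measurableSet_Ioo fun y hy => by
          refine ENNReal.ofReal_le_ofReal (mul_le_mul_of_nonneg_left ?_ (by positivity))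
          refine one_div_le_one_div_of_le (by linarith) (by nlinarith [hy.1, hy.2])
      _ = _ := hF
      _ ≤ 2 := by
          rw [← ENNReal.ofReal_ofNat]
          refine ENNReal.ofReal_le_ofReal (le_of_eq ?_)
          simp only [sub_self, Real.sqrt_zero, mul_zero, neg_zero, zero_div, zero_sub]
          field_simp
  calc _ ≤ _ := lintegral_mono_set e
    _ ≤ _ := lintegral_union_le _ _ _
    _ ≤ _ := add_le_add (lintegral_union_le _ _ _) le_rfl
    _ ≤ 2 + 0 + 2 := by
        refine add_le_add (add_le_add h1 (le_of_eq ?_)) h2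
        simp
    _ = 4 := by norm_num

/-- A Hilbert type inequality for the kernel `1 / (1 - x y)`. -/
theorem lintegral_lintegral_hilbert_le {d : ℝ → ℝ≥0∞} (hd : Measurable d) {ρ : ℝ} (hρ : ρ ≤ 1) :
    ∫⁻ x in Ioo 0 ρ, ∫⁻ y in Ioo 0 ρ, d x * d y * ENNReal.ofReal (1 / (1 - x * y)) ≤
      8 * ∫⁻ x in Ioo 0 ρ, d x ^ 2 := by
  set k : ℝ → ℝ → ℝ≥0∞ := fun x y => ENNReal.ofReal (√(1 - x) / √(1 - y) * (1 / (1 - x * y)))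
    with hk
  have hkm : Measurable fun p : ℝ × ℝ => k p.1 p.2 := by simp only [hk]; fun_prop
  have hdk : Measurable fun p : ℝ × ℝ => d p.1 ^ 2 * k p.1 p.2 :=
    ((hd.comp measurable_fst).pow_const 2).mul hkm
  have key : ∀ x ∈ Ioo 0 ρ, ∀ y ∈ Ioo 0 ρ, d x * d y * ENNReal.ofReal (1 / (1 - x * y)) ≤
      d x ^ 2 * k x y + d y ^ 2 * k y x := by
    intro x hx y hy
    have hs : 0 < 1 - x := by linarith [hx.2]
    have ht : 0 < 1 - y := by linarith [hy.2]
    have hss := Real.sqrt_pos.2 hs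
    have hst := Real.sqrt_pos.2 ht
    simp only [hk]
    rw [ENNReal.ofReal_mul (by positivity), ENNReal.ofReal_mul (by positivity), mul_comm y x,
      ← mul_assoc, ← mul_assoc, ← add_mul]
    gcongr
    set P := ENNReal.ofReal (√(1 - x) / √(1 - y)) with hP
    set Q := ENNReal.ofReal (√(1 - y) / √(1 - x)) with hQ
    have hPQ : P * Q = 1 := by
      rw [hP, hQ, ← ENNReal.ofReal_mul (by positivity), div_mul_div_comm, mul_comm (√(1 - y)),
        div_self (by positivity), ENNReal.ofReal_one]
    -- Since PQ = 1, whichever of d(y) and d(x)P is larger, one of the two summands alone dominates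
    -- the product.
    rcases le_total (d y) (d x * P) with h | h
    · calc d x * d y ≤ d x * (d x * P) := by gcongr
        _ = d x ^ 2 * P := by ring
        _ ≤ _ := le_self_add
    · calc d x * d y = (d x * P) * Q * d y := by rw [mul_assoc (d x), hPQ, mul_one]
        _ ≤ d y * Q * d y := by gcongr
        _ = d y ^ 2 * Q := by ring
        _ ≤ _ := le_add_self
  have half : ∫⁻ x in Ioo 0 ρ, ∫⁻ y in Ioo 0 ρ, d x ^ 2 * k x y ≤ 4 * ∫⁻ x in Ioo 0 ρ, d x ^ 2 := by
    rw [← lintegral_const_mul' _ _ (by simp)]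
    refine setLIntegral_mono' measurableSet_Ioo fun x hx => ?_
    have hkx : Measurable (k x) := hkm.comp (by fun_prop : Measurable fun y : ℝ => (x, y))
    rw [lintegral_const_mul _ hkx, mul_comm]
    gcongr
    exact (lintegral_mono_set (Ioo_subset_Ioo_right hρ)).trans
      (lintegral_schur_le ⟨hx.1, by linarith [hx.2]⟩)
  calc _ ≤ ∫⁻ x in Ioo 0 ρ, ∫⁻ y in Ioo 0 ρ, (d x ^ 2 * k x y + d y ^ 2 * k y x) :=
        setLIntegral_mono' measurableSet_Ioo fun x hx =>
          setLIntegral_mono' measurableSet_Ioo fun y hy => key x hx y hy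
    _ = ∫⁻ x in Ioo 0 ρ, ((∫⁻ y in Ioo 0 ρ, d x ^ 2 * k x y) +
          ∫⁻ y in Ioo 0 ρ, d y ^ 2 * k y x) := by
        congr 1; ext x
        exact lintegral_add_left (hdk.comp (by fun_prop : Measurable fun y : ℝ => (x, y))) _
    _ = (∫⁻ x in Ioo 0 ρ, ∫⁻ y in Ioo 0 ρ, d x ^ 2 * k x y) +
          ∫⁻ x in Ioo 0 ρ, ∫⁻ y in Ioo 0 ρ, d y ^ 2 * k y x :=
        lintegral_add_left hdk.lintegral_prod_right' _
    _ ≤ 4 * (∫⁻ x in Ioo 0 ρ, d x ^ 2) + 4 * ∫⁻ x in Ioo 0 ρ, d x ^ 2 := by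
        refine add_le_add half (le_of_eq_of_le ?_ half)
        exact lintegral_lintegral_swap (hdk.comp measurable_swap).aemeasurable
    _ = _ := by rw [← add_mul]; norm_num

/-! ### Superpositions of Szegő kernels. -/

section Moments

variable {α : Type*} [MeasurableSpace α] {m : Measure α} {H l : α → ℂ}

/-- Expanding 1/(1 - l z) in a geometric series under the integral: a superposition of Szegő kernels
has the moments of H against l as Taylor coefficients. -/
theorem hasSum_moment (hH : Integrable H m) (hl : AEStronglyMeasurable l m)
    (hl1 : ∀ᵐ x ∂m, ‖l x‖ ≤ 1) {z : ℂ} (hz : ‖z‖ < 1) :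
    HasSum (fun n : ℕ => (∫ x, H x * l x ^ n ∂m) * z ^ n) (∫ x, H x * (1 / (1 - l x * z)) ∂m) := by
  simp only [← integral_mul_const]
  have hg : Summable fun n : ℕ => ‖z‖ ^ n := summable_geometric_of_lt_one (norm_nonneg _) hz
  refine hasSum_integral_of_dominated_convergence (fun n x => ‖H x‖ * ‖z‖ ^ n)
    (fun n => (hH.aestronglyMeasurable.mul (hl.pow n)).mul aestronglyMeasurable_const) ?_ ?_ ?_ ?_
  · intro n
    filter_upwards [hl1] with x hx
    rw [norm_mul, norm_mul, norm_pow, norm_pow]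
    gcongr
    exact mul_le_of_le_one_right (norm_nonneg _) (pow_le_one₀ (norm_nonneg _) hx)
  · exact Filter.Eventually.of_forall fun x => hg.mul_left _
  · simp only [tsum_mul_left]
    exact hH.norm.mul_const _
  · filter_upwards [hl1] with x hx
    have hlz : ‖l x * z‖ < 1 := by
      rw [norm_mul]; nlinarith [norm_nonneg (l x), norm_nonneg z]
    have := (hasSum_geometric_of_norm_lt_one hlz).mul_left (H x)
    rw [one_div]
    refine this.congr_fun fun n => ?_
    rw [mul_pow]; ring

theorem hasSum_succ_mul_moment (hH : Integrable H m) (hl : AEStronglyMeasurable l m)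
    (hl1 : ∀ᵐ x ∂m, ‖l x‖ ≤ 1) {z : ℂ} (hz : ‖z‖ < 1) :
    HasSum (fun n : ℕ => (n + 1) * (∫ x, H x * l x ^ n ∂m) * z ^ n)
      (∫ x, H x * (1 / (1 - l x * z) ^ 2) ∂m) := by
  simp only [← integral_const_mul, ← integral_mul_const]
  have hg : Summable fun n : ℕ => ‖((n : ℂ) + 1) * z ^ n‖ := (hasSum_succ_mul_geometric hz).summable.norm
  refine hasSum_integral_of_dominated_convergence (fun n x => ‖H x‖ * ‖((n : ℂ) + 1) * z ^ n‖)
    (fun n => (aestronglyMeasurable_const.mul (hH.aestronglyMeasurable.mul (hl.pow n))).mul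
      aestronglyMeasurable_const) ?_ ?_ ?_ ?_
  · intro n
    filter_upwards [hl1] with x hx
    have : ((n : ℂ) + 1) * (H x * l x ^ n) * z ^ n = H x * l x ^ n * (((n : ℂ) + 1) * z ^ n) := by
      ring
    rw [this, norm_mul, norm_mul (H x), norm_pow]
    gcongr
    exact mul_le_of_le_one_right (norm_nonneg _) (pow_le_one₀ (norm_nonneg _) hx)
  · exact Filter.Eventually.of_forall fun x => hg.mul_left _
  · simp only [tsum_mul_left]
    exact hH.norm.mul_const _
  · filter_upwards [hl1] with x hx
    have hlz : ‖l x * z‖ < 1 := by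
      rw [norm_mul]; nlinarith [norm_nonneg (l x), norm_nonneg z]
    refine ((hasSum_succ_mul_geometric hlz).mul_left (H x)).congr_fun fun n => ?_
    rw [mul_pow]; ring

theorem enorm_geom_sum_le {q : ℂ} (hq : ‖q‖ < 1) (N : ℕ) :
    ‖∑ n ∈ Finset.range N, q ^ n‖ₑ ≤ ENNReal.ofReal (2 / ‖1 - q‖) := by
  have h1 : 1 - q ≠ 0 := sub_ne_zero.2 fun h => by rw [← h, norm_one] at hq; exact lt_irrefl _ hq
  have h2 : 0 < ‖1 - q‖ := norm_pos_iff.2 h1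
  rw [← ofReal_norm]
  refine ENNReal.ofReal_le_ofReal ?_
  rw [le_div_iff₀ h2, ← norm_mul, geom_sum_mul_neg]
  refine (norm_sub_le _ _).trans ?_
  rw [norm_one, norm_pow]
  linarith [pow_le_one₀ (n := N) (norm_nonneg q) hq.le]

/-- Each squared moment is a double integral, and summing over n < N puts a truncated geometric
series in l(x) l̄(y) inside it. Such partial sums are at most 2/|1 - l(x) l̄(y)| whatever N is, so
only finite sums are interchanged with integrals. -/
theorem tsum_moment_sq_le [SFinite m] (hH : Integrable H m) (hl : AEStronglyMeasurable l m)
    (hl1 : ∀ᵐ x ∂m, ‖l x‖ < 1) :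
    ∑' n : ℕ, ‖∫ x, H x * l x ^ n ∂m‖ₑ ^ 2 ≤
      ∫⁻ x, ∫⁻ y, ‖H x‖ₑ * ‖H y‖ₑ * ENNReal.ofReal (2 / ‖1 - l x * conj (l y)‖) ∂m ∂m := by
  refine ENNReal.tsum_le_of_sum_range_le fun N => ?_
  have hint : ∀ n : ℕ, Integrable (fun x => H x * l x ^ n) m := fun n =>
    hH.norm.mono' (hH.aestronglyMeasurable.mul (hl.pow n)) (by
      filter_upwards [hl1] with x hx
      rw [norm_mul, norm_pow]
      exact mul_le_of_le_one_right (norm_nonneg _) (pow_le_one₀ (norm_nonneg _) hx.le))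
  have hprod : ∀ n : ℕ, (∫ x, H x * l x ^ n ∂m) * conj (∫ x, H x * l x ^ n ∂m) =
      ∫ p : α × α, (H p.1 * l p.1 ^ n) * conj (H p.2 * l p.2 ^ n) ∂m.prod m := by
    intro n
    rw [integral_prod_mul (fun x => H x * l x ^ n) (fun y => conj (H y * l y ^ n)), integral_conj]
  have hint2 : ∀ n : ℕ, Integrable
      (fun p : α × α => (H p.1 * l p.1 ^ n) * conj (H p.2 * l p.2 ^ n)) (m.prod m) := fun n =>
    (hint n).mul_prod (Complex.conjCLE.toContinuousLinearMap.integrable_comp (hint n))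
  have hreal : ∑ n ∈ Finset.range N, ‖∫ x, H x * l x ^ n ∂m‖ₑ ^ 2 =
      ‖∑ n ∈ Finset.range N, (∫ x, H x * l x ^ n ∂m) * conj (∫ x, H x * l x ^ n ∂m)‖ₑ := by
    have e : ∀ b : ℂ, b * conj b = ((‖b‖ ^ 2 : ℝ) : ℂ) := fun b => by
      rw [Complex.mul_conj, Complex.normSq_eq_norm_sq]
    simp only [e]
    rw [← Complex.ofReal_sum, ← ofReal_norm, Complex.norm_real,
      Real.norm_of_nonneg (Finset.sum_nonneg fun n _ => by positivity),
      ENNReal.ofReal_sum_of_nonneg fun n _ => by positivity]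
    refine Finset.sum_congr rfl fun n _ => ?_
    rw [ENNReal.ofReal_pow (norm_nonneg _), ofReal_norm]
  rw [hreal]
  simp only [hprod]
  rw [← integral_finsetSum _ fun n _ => hint2 n]
  refine (enorm_integral_le_lintegral_enorm _).trans ?_
  rw [lintegral_prod _ (integrable_finsetSum _ fun n _ => hint2 n).aestronglyMeasurable.enorm]
  refine lintegral_mono_ae (hl1.mono fun x hx => lintegral_mono_ae (hl1.mono fun y hy => ?_))
  have e : ∑ n ∈ Finset.range N, (H x * l x ^ n) * conj (H y * l y ^ n) =
      (H x * conj (H y)) * ∑ n ∈ Finset.range N, (l x * conj (l y)) ^ n := by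
    rw [Finset.mul_sum]
    refine Finset.sum_congr rfl fun n _ => ?_
    rw [map_mul, map_pow, mul_pow]; ring
  have hq : ‖l x * conj (l y)‖ < 1 := by
    rw [norm_mul, RCLike.norm_conj]; nlinarith [norm_nonneg (l x), norm_nonneg (l y)]
  simp only
  rw [e, enorm_mul, enorm_mul, ← ofReal_norm (conj (H y)), RCLike.norm_conj, ofReal_norm]
  gcongr
  exact enorm_geom_sum_le hq N

end Moments

theorem norm_ofReal_mul_conj {e : ℂ} (he : ‖e‖ = 1) {x : ℝ} (hx : 0 ≤ x) :
    ‖(x : ℂ) * conj e‖ = x := by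
  rw [norm_mul, RCLike.norm_conj, he, Complex.norm_real, Real.norm_of_nonneg hx, mul_one]

/-- The superposition `∫_0^ρ c(x) / (1 - x conj e ζ) dx` of Szegő kernels along a radius. -/
noncomputable def szegoSum (c : ℝ → ℝ) (e : ℂ) (ρ : ℝ) (ζ : ℂ) : ℂ :=
  ∫ x in Ioo 0 ρ, (c x : ℂ) * (1 / (1 - x * conj e * ζ))

section SzegoSum

variable {c : ℝ → ℝ} {e : ℂ} {ρ M : ℝ}

theorem ae_mem_Ioo : ∀ᵐ x ∂volume.restrict (Ioo 0 ρ), x ∈ Ioo 0 ρ :=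
  ae_restrict_mem measurableSet_Ioo

theorem integrable_mul_bounded (hc : Measurable c) (hM : ∀ x ∈ Ioo 0 ρ, |c x| ≤ M) {g : ℝ → ℂ}
    (hg : Measurable g) {A : ℝ} (hA : ∀ x ∈ Ioo 0 ρ, ‖g x‖ ≤ A) :
    Integrable (fun x => (c x : ℂ) * g x) (volume.restrict (Ioo 0 ρ)) := by
  have : IsFiniteMeasure (volume.restrict (Ioo 0 ρ)) := ⟨by simp⟩
  refine Integrable.of_bound (C := M * A) (by fun_prop : Measurable _).aestronglyMeasurable
    (ae_mem_Ioo.mono fun x hx => ?_)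
  rw [norm_mul, Complex.norm_real, Real.norm_eq_abs]
  exact mul_le_mul (hM x hx) (hA x hx) (norm_nonneg _) ((abs_nonneg _).trans (hM x hx))

theorem hasSum_szegoSum (hc : Measurable c) (hM : ∀ x ∈ Ioo 0 ρ, |c x| ≤ M) (he : ‖e‖ = 1)
    (hρ : ρ < 1) {z : ℂ} (hz : z ∈ disc) :
    HasSum (fun n : ℕ => (∫ x in Ioo 0 ρ, (c x : ℂ) * (x * conj e) ^ n) * z ^ n)
      (szegoSum c e ρ z) := by
  have hH : Integrable (fun x => (c x : ℂ)) (volume.restrict (Ioo 0 ρ)) := by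
    simpa using integrable_mul_bounded hc hM (g := fun _ => 1) measurable_const (A := 1) (by simp)
  exact hasSum_moment hH (by fun_prop : Measurable fun x : ℝ => (x : ℂ) * conj e).aestronglyMeasurable
    (ae_mem_Ioo.mono fun x hx => by rw [norm_ofReal_mul_conj he hx.1.le]; linarith [hx.2])
    (mem_disc.1 hz)

theorem deriv_szegoSum (hc : Measurable c) (hM : ∀ x ∈ Ioo 0 ρ, |c x| ≤ M) (he : ‖e‖ = 1)
    (hρ : ρ < 1) {z : ℂ} (hz : z ∈ disc) :
    deriv (szegoSum c e ρ) z =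
      ∫ x in Ioo 0 ρ, (c x : ℂ) * (x * conj e) * (1 / (1 - x * conj e * z) ^ 2) := by
  have h1 := deriv_eq_tsum_of_hasSum (fun z hz => hasSum_szegoSum hc hM he hρ hz) hz
  have hH : Integrable (fun x => (c x : ℂ) * ((x : ℂ) * conj e)) (volume.restrict (Ioo 0 ρ)) :=
    integrable_mul_bounded hc hM (by fun_prop) (A := 1)
      (fun x hx => by rw [norm_ofReal_mul_conj he hx.1.le]; linarith [hx.2])
  have h2 := hasSum_succ_mul_moment hH
    (by fun_prop : Measurable fun x : ℝ => (x : ℂ) * conj e).aestronglyMeasurable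
    (ae_mem_Ioo.mono fun x hx => by rw [norm_ofReal_mul_conj he hx.1.le]; linarith [hx.2])
    (mem_disc.1 hz)
  refine h1.unique (h2.congr_fun fun n => ?_)
  congr 3; ext x; ring

theorem enorm_ofReal_sq (x : ℝ) : ‖(x : ℂ)‖ₑ ^ 2 = ENNReal.ofReal (x ^ 2) := by
  rw [← ofReal_norm, Complex.norm_real, ← ENNReal.ofReal_pow (norm_nonneg _), Real.norm_eq_abs,
    sq_abs]

theorem mul_conj_mul_conj_conj (he : ‖e‖ = 1) (x y : ℝ) :
    (x : ℂ) * conj e * conj ((y : ℂ) * conj e) = ((x * y : ℝ) : ℂ) := by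
  have h : e * conj e = 1 := by
    rw [Complex.mul_conj, Complex.normSq_eq_norm_sq, he]; simp
  rw [map_mul, Complex.conj_conj, Complex.conj_ofReal]
  push_cast
  linear_combination (x * y : ℂ) * h

/-- The Hardy norm of a superposition of Szegő kernels. -/
theorem tsum_taylorCoeff_szegoSum_le (hc : Measurable c) (hM : ∀ x ∈ Ioo 0 ρ, |c x| ≤ M)
    (he : ‖e‖ = 1) (hρ : ρ < 1) :
    ∑' n, ‖taylorCoeff (szegoSum c e ρ) n‖ₑ ^ 2 ≤ 16 * ∫⁻ x in Ioo 0 ρ, ENNReal.ofReal (c x ^ 2) := by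
  simp only [taylorCoeff_eq_of_hasSum (fun z hz => hasSum_szegoSum hc hM he hρ hz)]
  have hH : Integrable (fun x => (c x : ℂ)) (volume.restrict (Ioo 0 ρ)) := by
    simpa using integrable_mul_bounded hc hM (g := fun _ => 1) measurable_const (A := 1) (by simp)
  have h1 := tsum_moment_sq_le hH
    (by fun_prop : Measurable fun x : ℝ => (x : ℂ) * conj e).aestronglyMeasurable
    (ae_mem_Ioo.mono fun x hx => by rw [norm_ofReal_mul_conj he hx.1.le]; linarith [hx.2])
  have h2 := lintegral_lintegral_hilbert_le (d := fun x => ‖(c x : ℂ)‖ₑ) (by fun_prop) hρ.le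
  calc _ ≤ _ := h1
    _ = ∫⁻ x in Ioo 0 ρ, ∫⁻ y in Ioo 0 ρ,
          2 * (‖(c x : ℂ)‖ₑ * ‖(c y : ℂ)‖ₑ * ENNReal.ofReal (1 / (1 - x * y))) := by
        refine setLIntegral_congr_fun measurableSet_Ioo fun x hx =>
          setLIntegral_congr_fun measurableSet_Ioo fun y hy => ?_
        have hxy : 0 < 1 - x * y := by nlinarith [hx.1, hx.2, hy.1, hy.2]
        rw [mul_conj_mul_conj_conj he, ← Complex.ofReal_one, ← Complex.ofReal_sub,
          Complex.norm_real, Real.norm_of_nonneg hxy.le, ← mul_one_div,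
          ENNReal.ofReal_mul zero_le_two, ENNReal.ofReal_ofNat]
        ring
    _ = 2 * ∫⁻ x in Ioo 0 ρ, ∫⁻ y in Ioo 0 ρ,
          (‖(c x : ℂ)‖ₑ * ‖(c y : ℂ)‖ₑ * ENNReal.ofReal (1 / (1 - x * y))) := by
        simp only [lintegral_const_mul' _ _ ENNReal.ofNat_ne_top]
    _ ≤ 2 * _ := mul_le_mul_right h2 _
    _ = _ := by
        simp only [enorm_ofReal_sq]
        rw [← mul_assoc]; norm_num

/-- The polarized form of `one_sub_normSq_moebius`. For nodes ξ = xē and η = yē one has 1 - ξη̄ = 1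
- xy, so the Hilbert kernel reappears after the change of variable. -/
theorem one_sub_moebius_mul_conj {w ξ η : ℂ} (h1 : 1 - w * ξ ≠ 0) (h2 : 1 - w * η ≠ 0) :
    1 - moebius (conj w) ξ * conj (moebius (conj w) η) =
      (1 - conj w * w) * (1 - ξ * conj η) / ((1 - w * ξ) * conj (1 - w * η)) := by
  have h3 : conj (1 - w * η) ≠ 0 := (map_ne_zero _).2 h2
  rw [moebius, moebius, Complex.conj_conj, map_div₀, div_mul_div_comm, eq_div_iff (mul_ne_zero h1 h3),
    sub_mul, div_mul_cancel₀ _ (mul_ne_zero h1 h3)]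
  simp only [map_sub, map_mul, map_one, Complex.conj_conj]
  ring

/-- The Green-weighted Dirichlet integral of a superposition of Szegő kernels. -/
theorem lintegral_deriv_szegoSum_greenKernel_le (hc : Measurable c)
    (hM : ∀ x ∈ Ioo 0 ρ, |c x| ≤ M) (he : ‖e‖ = 1) (hρ : ρ < 1) {w : ℂ} (hw : w ∈ disc) :
    ∫⁻ z, ‖deriv (szegoSum c e ρ) z‖ₑ ^ 2 * greenKernel z w ∂areaMeasure ≤
      8 * ∫⁻ x in Ioo 0 ρ,
        ENNReal.ofReal (c x ^ 2 * ((1 - ‖w‖ ^ 2) / ‖1 - w * (x * conj e)‖ ^ 2)) := by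
  have hw1 := mem_disc.1 hw
  have hp := one_sub_normSq_pos hw
  set ξ : ℝ → ℂ := fun x => (x : ℂ) * conj e with hξ
  have hξm : Measurable ξ := by simp only [hξ]; fun_prop
  have hξd : ∀ x ∈ Ioo 0 ρ, ξ x ∈ disc := fun x hx => by
    rw [mem_disc, hξ, norm_ofReal_mul_conj he hx.1.le]; linarith [hx.2]
  have hcw : conj w ∈ disc := by rw [mem_disc, RCLike.norm_conj]; exact hw1
  have hne : ∀ x ∈ Ioo 0 ρ, 1 - w * ξ x ≠ 0 := fun x hx =>
    one_sub_mul_ne_zero hw1.le (mem_disc.1 (hξd x hx))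
  -- Composition with φ_w moves the Szegő node ξ to φ_{w̄}(ξ); the remaining factors of the
  -- differentiated kernel do not depend on z and go into H.
  set l : ℝ → ℂ := fun x => moebius (conj w) (ξ x) with hl
  have hlm : Measurable l := by simp only [hl, moebius]; fun_prop
  set H : ℝ → ℂ := fun x => (c x : ℂ) * (ξ x * (-(1 - conj w * w) / (1 - w * ξ x) ^ 2)) with hHd
  have hH : Integrable H (volume.restrict (Ioo 0 ρ)) := by
    refine integrable_mul_bounded hc hM (by fun_prop) (A := (1 - ‖w‖ ^ 2) / (1 - ‖w‖) ^ 2)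
      fun x hx => ?_
    have hlow : 1 - ‖w‖ ≤ ‖1 - w * ξ x‖ := by
      have := norm_sub_norm_le 1 (w * ξ x)
      rw [norm_one, norm_mul] at this
      nlinarith [norm_nonneg w, mem_disc.1 (hξd x hx), norm_nonneg (ξ x)]
    rw [norm_mul, norm_div, norm_neg, one_sub_conj_mul_self, Complex.norm_real,
      Real.norm_of_nonneg hp.le, norm_pow]
    refine (mul_le_of_le_one_left (by positivity) (mem_disc.1 (hξd x hx)).le).trans ?_
    have : 0 < 1 - ‖w‖ := by linarith
    gcongr
  have hdiff : DifferentiableOn ℂ (szegoSum c e ρ) disc :=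
    differentiableOn_of_hasSum fun z hz => hasSum_szegoSum hc hM he hρ hz
  have hseries : ∀ z ∈ disc, HasSum
      (fun n : ℕ => (n + 1) * (∫ x in Ioo 0 ρ, H x * l x ^ n) * z ^ n)
      (deriv (szegoSum c e ρ) (moebius w z) * (-(1 - conj w * w) / (1 - conj w * z) ^ 2)) := by
    intro z hz
    have hlt : ∀ x ∈ Ioo 0 ρ, ‖l x‖ ≤ 1 := fun x hx =>
      (mem_disc.1 (moebius_mem_disc hcw (hξd x hx))).le
    have h := hasSum_succ_mul_moment hH hlm.aestronglyMeasurable (ae_mem_Ioo.mono hlt)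
      (mem_disc.1 hz)
    convert h using 1
    rw [deriv_szegoSum hc hM he hρ (moebius_mem_disc hw hz), ← integral_mul_const]
    refine setIntegral_congr_fun measurableSet_Ioo fun x hx => ?_
    have hx1 := hne x hx
    have hz1 := one_sub_conj_mul_ne_zero hw hz
    have key : (1 - ξ x * moebius w z) * (1 - conj w * z) = (1 - w * ξ x) * (1 - l x * z) := by
      have a1 : moebius w z * (1 - conj w * z) = w - z := div_mul_cancel₀ _ hz1
      have a2 : l x * (1 - w * ξ x) = conj w - ξ x := by
        simp only [hl, moebius, Complex.conj_conj]
        exact div_mul_cancel₀ _ hx1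
      linear_combination (-ξ x) * a1 + z * a2
    have e1 : 1 / (1 - ξ x * moebius w z) ^ 2 * (1 / (1 - conj w * z) ^ 2) =
        1 / (1 - w * ξ x) ^ 2 * (1 / (1 - l x * z) ^ 2) := by
      rw [one_div_mul_one_div, one_div_mul_one_div, ← mul_pow, ← mul_pow, key]
    simp only [hHd]
    calc (c x : ℂ) * ξ x * (1 / (1 - ξ x * moebius w z) ^ 2) *
          (-(1 - conj w * w) / (1 - conj w * z) ^ 2)
        = (c x : ℂ) * ξ x * -(1 - conj w * w) *
          (1 / (1 - ξ x * moebius w z) ^ 2 * (1 / (1 - conj w * z) ^ 2)) := by ring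
      _ = _ := by rw [e1]; ring
  rw [lintegral_norm_sq_mul_greenKernel hw (differentiableOn_deriv hdiff).continuousOn hseries]
  have h1 := tsum_moment_sq_le hH hlm.aestronglyMeasurable
    (ae_mem_Ioo.mono fun x hx => mem_disc.1 (moebius_mem_disc hcw (hξd x hx)))
  -- H carries |1 - wξ|⁻², and dividing by 1 - l(x) l̄(y) gives back one power at each node. What
  -- remains is d(x) d(y)/(1-xy), with a single factor 1 - |w|².
  set d : ℝ → ℝ≥0∞ := fun x => ENNReal.ofReal (|c x| / ‖1 - w * ξ x‖) with hd
  have hdm : Measurable d := by fun_prop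
  have h2 := lintegral_lintegral_hilbert_le hdm hρ.le
  have h3 : ∀ x ∈ Ioo 0 ρ, ∀ y ∈ Ioo 0 ρ,
      ‖H x‖ₑ * ‖H y‖ₑ * ENNReal.ofReal (2 / ‖1 - l x * conj (l y)‖) ≤
        (2 * ENNReal.ofReal (1 - ‖w‖ ^ 2)) *
          (d x * d y * ENNReal.ofReal (1 / (1 - x * y))) := by
    intro x hx y hy
    have hx1 := norm_pos_iff.2 (hne x hx)
    have hy1 := norm_pos_iff.2 (hne y hy)
    have hxy : 0 < 1 - x * y := by nlinarith [hx.1, hx.2, hy.1, hy.2]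
    have hHn : ∀ x ∈ Ioo 0 ρ, ‖H x‖ ≤ |c x| * ((1 - ‖w‖ ^ 2) / ‖1 - w * ξ x‖ ^ 2) := by
      intro x hx
      simp only [hHd]
      rw [norm_mul, norm_mul, norm_div, norm_neg, one_sub_conj_mul_self, Complex.norm_real,
        Complex.norm_real, Real.norm_eq_abs, Real.norm_of_nonneg hp.le, norm_pow]
      gcongr
      exact mul_le_of_le_one_left (by positivity) (mem_disc.1 (hξd x hx)).le
    simp only [hl, hd]
    rw [one_sub_moebius_mul_conj (hne x hx) (hne y hy), mul_conj_mul_conj_conj he,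
      one_sub_conj_mul_self, ← Complex.ofReal_one, ← Complex.ofReal_sub, norm_div, norm_mul,
      norm_mul, RCLike.norm_conj, Complex.norm_real, Complex.norm_real, Real.norm_of_nonneg hp.le,
      Real.norm_of_nonneg hxy.le, Complex.ofReal_one, ← ofReal_norm (H x), ← ofReal_norm (H y),
      ← ENNReal.ofReal_mul (by positivity), ← ENNReal.ofReal_mul (by positivity),
      ← ENNReal.ofReal_mul (by positivity), ← ENNReal.ofReal_mul (by positivity),
      ← ENNReal.ofReal_ofNat, ← ENNReal.ofReal_mul (by positivity),
      ← ENNReal.ofReal_mul (by positivity)]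
    refine ENNReal.ofReal_le_ofReal ?_
    calc _ ≤ (|c x| * ((1 - ‖w‖ ^ 2) / ‖1 - w * ξ x‖ ^ 2)) *
          (|c y| * ((1 - ‖w‖ ^ 2) / ‖1 - w * ξ y‖ ^ 2)) *
          (2 / ((1 - ‖w‖ ^ 2) * (1 - x * y) / (‖1 - w * ξ x‖ * ‖1 - w * ξ y‖))) := by
          gcongr
          · exact hHn x hx
          · exact hHn y hy
      _ = _ := by field_simp
  calc 2⁻¹ * ∑' n : ℕ, ‖∫ x in Ioo 0 ρ, H x * l x ^ n‖ₑ ^ 2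
      ≤ 2⁻¹ * ((2 * ENNReal.ofReal (1 - ‖w‖ ^ 2)) * ∫⁻ x in Ioo 0 ρ, ∫⁻ y in Ioo 0 ρ,
          d x * d y * ENNReal.ofReal (1 / (1 - x * y))) := by
        gcongr
        refine h1.trans ?_
        have hfin : 2 * ENNReal.ofReal (1 - ‖w‖ ^ 2) ≠ ⊤ :=
          ENNReal.mul_ne_top (by simp) ENNReal.ofReal_ne_top
        simp only [← lintegral_const_mul' _ _ hfin]
        exact setLIntegral_mono' measurableSet_Ioo fun x hx =>
          setLIntegral_mono' measurableSet_Ioo fun y hy => h3 x hx y hy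
    _ ≤ 2⁻¹ * ((2 * ENNReal.ofReal (1 - ‖w‖ ^ 2)) * (8 * ∫⁻ x in Ioo 0 ρ, d x ^ 2)) := by gcongr
    _ = 8 * (ENNReal.ofReal (1 - ‖w‖ ^ 2) * ∫⁻ x in Ioo 0 ρ, d x ^ 2) := by
        rw [mul_assoc 2, ← mul_assoc 2⁻¹, ENNReal.inv_mul_cancel (by simp) (by simp), one_mul]
        ring
    _ = _ := by
        rw [← lintegral_const_mul' _ _ ENNReal.ofReal_ne_top]
        congr 2; ext x
        simp only [hd]
        rw [← ENNReal.ofReal_pow (by positivity), ← ENNReal.ofReal_mul hp.le]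
        congr 1
        rw [div_pow, sq_abs]; ring

end SzegoSum

/-! ### The Green potential as a weight, and the test function. -/

instance sFinite_areaMeasure : SFinite areaMeasure := by unfold areaMeasure; infer_instance

theorem ae_mem_disc : ∀ᵐ z ∂areaMeasure, z ∈ disc :=
  Measure.ae_smul_measure (ae_restrict_mem measurableSet_disc) _

section Weight

variable {ω : ℂ → ℝ≥0∞} {μ : Measure ℂ}

theorem lintegral_mul_weight (hω : IsPureSuperharmonicWeight ω μ) {F : ℂ → ℝ≥0∞}
    (hF : AEMeasurable F areaMeasure) :
    ∫⁻ z, F z * ω z ∂areaMeasure =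
      ∫⁻ w in disc, ∫⁻ z, F z * greenKernel z w ∂areaMeasure ∂μ := by
  have := sFinite_restrict_disc hω.riesz_finite
  rw [lintegral_lintegral_swap]
  · refine lintegral_congr_ae (ae_mem_disc.mono fun z hz => ?_)
    have : Measurable (greenKernel z) :=
      measurable_greenKernel.comp (by fun_prop : Measurable fun w : ℂ => (z, w))
    simp only
    rw [lintegral_const_mul _ this, hω.eq_green z hz, greenPotential]
  · exact (hF.comp_quasiMeasurePreserving Measure.quasiMeasurePreserving_snd).mul
      (measurable_greenKernel.comp measurable_swap).aemeasurable

theorem aemeasurable_weight (hω : IsPureSuperharmonicWeight ω μ) : AEMeasurable ω areaMeasure := by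
  have := sFinite_restrict_disc hω.riesz_finite
  have h : Measurable (greenPotential μ) := measurable_greenKernel.lintegral_prod_right'
  exact h.aemeasurable.congr (ae_mem_disc.mono fun z hz => (hω.eq_green z hz).symm)

theorem weight_lt_top (hω : IsPureSuperharmonicWeight ω μ) : ∀ᵐ z ∂areaMeasure, ω z < ⊤ := by
  refine ae_lt_top' (aemeasurable_weight hω) (ne_of_lt ?_)
  have h := lintegral_mul_weight hω (F := fun _ => 1) aemeasurable_const
  simp only [one_mul] at h
  rw [h]
  exact (setLIntegral_mono' measurableSet_disc fun w hw => lintegral_greenKernel_le hw).trans_lt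
    hω.riesz_finite

/-- The one-pole estimate integrated in w: (1-|w|²)/|1 - x e w̄|² is the integrand of V_μ(xe)
divided by 1 - x². -/
theorem dirichletIntegral_szegoSum_le (hω : IsPureSuperharmonicWeight ω μ) {c : ℝ → ℝ} {e : ℂ}
    {ρ M : ℝ} (hc : Measurable c) (hM : ∀ x ∈ Ioo 0 ρ, |c x| ≤ M) (he : ‖e‖ = 1) (hρ : ρ < 1) :
    dirichletIntegral ω (szegoSum c e ρ) ≤ 8 * ∫⁻ x in Ioo 0 ρ,
      ENNReal.ofReal (c x ^ 2 / (1 - x ^ 2)) * lintegralV μ (x * e) := by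
  have := sFinite_restrict_disc hω.riesz_finite
  have hdiff : DifferentiableOn ℂ (szegoSum c e ρ) disc :=
    differentiableOn_of_hasSum fun z hz => hasSum_szegoSum hc hM he hρ hz
  rw [dirichletIntegral, lintegral_mul_weight hω ((aestronglyMeasurable_areaMeasure
    (differentiableOn_deriv hdiff).continuousOn).enorm.pow_const 2)]
  calc _ ≤ ∫⁻ w in disc, (8 * ∫⁻ x in Ioo 0 ρ,
        ENNReal.ofReal (c x ^ 2 * ((1 - ‖w‖ ^ 2) / ‖1 - w * (x * conj e)‖ ^ 2))) ∂μ :=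
        setLIntegral_mono' measurableSet_disc fun w hw =>
          lintegral_deriv_szegoSum_greenKernel_le hc hM he hρ hw
    _ = 8 * ∫⁻ x in Ioo 0 ρ, ∫⁻ w in disc,
        ENNReal.ofReal (c x ^ 2 * ((1 - ‖w‖ ^ 2) / ‖1 - w * (x * conj e)‖ ^ 2)) ∂μ := by
        rw [lintegral_const_mul' _ _ (by simp), lintegral_lintegral_swap]
        exact (by fun_prop : Measurable fun p : ℂ × ℝ => ENNReal.ofReal
          (c p.2 ^ 2 * ((1 - ‖p.1‖ ^ 2) / ‖1 - p.1 * (p.2 * conj e)‖ ^ 2))).aemeasurable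
    _ = _ := by
        congr 1
        refine setLIntegral_congr_fun measurableSet_Ioo fun x hx => ?_
        have hx2 : 0 < 1 - x ^ 2 := by nlinarith [hx.1, hx.2]
        simp only [lintegralV]
        rw [← lintegral_const_mul' _ _ ENNReal.ofReal_ne_top]
        congr 1; ext w
        rw [← ENNReal.ofReal_mul (by positivity)]
        congr 1
        have e1 : ‖1 - w * (x * conj e)‖ = ‖1 - x * e * conj w‖ := by
          rw [← RCLike.norm_conj]
          congr 1
          simp only [map_sub, map_mul, map_one, Complex.conj_conj, Complex.conj_ofReal]
          ring
        rw [berezinKernel, e1, norm_mul, he, Complex.norm_real, Real.norm_of_nonneg hx.1.le, mul_one]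
        field_simp

theorem memDirichlet_of_dirichletNormSq_lt_top {f : ℂ → ℂ} (hf : DifferentiableOn ℂ f disc)
    (h : dirichletNormSq ω f < ⊤) : MemDirichlet ω f := by
  rw [dirichletNormSq, ENNReal.add_lt_top] at h
  refine ⟨⟨hf, ?_⟩, h.2⟩
  have := ENNReal.summable_toReal h.1.ne
  simpa using this

/-- The test function for the lower estimate of the reproducing kernel. -/
theorem exists_memDirichlet_radialSize_le (hω : IsPureSuperharmonicWeight ω μ) {z : ℂ}
    (hz : z ∈ disc) (hz0 : z ≠ 0) :
    ∃ f : ℂ → ℂ, MemDirichlet ω f ∧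
      dirichletNormSq ω f ≤ 24 * radialSize μ (z / (‖z‖ : ℂ)) ‖z‖ ∧
      radialSize μ (z / (‖z‖ : ℂ)) ‖z‖ ≤ 2 * ‖f z‖ₑ := by
  have := sFinite_restrict_disc hω.riesz_finite
  set e : ℂ := z / (‖z‖ : ℂ) with hedef
  set ρ : ℝ := ‖z‖ with hρdef
  have he : ‖e‖ = 1 := norm_div_norm hz0
  have hρ : ρ < 1 := mem_disc.1 hz
  set ψ := radialWeight μ e with hψ
  have hψm : Measurable ψ := measurable_radialWeight μ e
  have hψpos : ∀ x ∈ Ioo 0 ρ, 0 < ψ x := fun x hx => radialWeight_pos μ e (by linarith [hx.2])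
  -- This choice makes both costs at most 1/ψ: c² ≤ 1/ψ because (1-x)² ≤ ψ, and c² V_μ(xe)/(1-x²) ≤
  -- 1/ψ because (1-x)V_μ(xe) ≤ ψ.
  set c : ℝ → ℝ := fun x => (1 - x) / ψ x with hcdef
  have hc : Measurable c := by fun_prop
  have hcle : ∀ x ∈ Ioo 0 ρ, (1 - x) ^ 2 ≤ ψ x := fun x hx =>
    sq_le_radialWeight μ e (by linarith [hx.2])
  have hM : ∀ x ∈ Ioo 0 ρ, |c x| ≤ 1 / (1 - ρ) := fun x hx => by
    have h1 : 0 < 1 - x := by linarith [hx.2]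
    have h2 := hψpos x hx
    rw [abs_of_nonneg (by positivity), hcdef, div_le_div_iff₀ h2 (by linarith)]
    nlinarith [hcle x hx, hx.2]
  have hsum := fun z hz => hasSum_szegoSum hc hM he hρ (z := z) hz
  have hdiff := differentiableOn_of_hasSum hsum
  have hnorm : dirichletNormSq ω (szegoSum c e ρ) ≤ 24 * radialSize μ e ρ := by
    have h1 := tsum_taylorCoeff_szegoSum_le hc hM he hρ
    have h2 := dirichletIntegral_szegoSum_le hω hc hM he hρ
    rw [dirichletNormSq, (by norm_num : (24 : ℝ≥0∞) = 16 + 8), add_mul]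
    refine add_le_add (h1.trans ?_) (h2.trans ?_)
    · gcongr 16 * ?_
      refine setLIntegral_mono' measurableSet_Ioo fun x hx => ENNReal.ofReal_le_ofReal ?_
      have h2 := hψpos x hx
      rw [hcdef, div_pow, div_le_div_iff₀ (by positivity) h2]
      nlinarith [hcle x hx]
    · gcongr 8 * ?_
      refine setLIntegral_mono' measurableSet_Ioo fun x hx => ?_
      have h1 : 0 < 1 - x := by linarith [hx.2]
      have h2 := hψpos x hx
      have hx2 : 0 < 1 - x ^ 2 := by nlinarith [hx.1, hx.2]
      have hd := ofReal_mul_mem_disc he hx.1.le (by linarith [hx.2])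
      rw [← ENNReal.ofReal_toReal (lintegralV_lt_top hω.riesz_finite hd).ne,
        ← ENNReal.ofReal_mul (by positivity)]
      refine ENNReal.ofReal_le_ofReal ?_
      set v := (lintegralV μ (x * e)).toReal with hv
      have hv0 : 0 ≤ v := ENNReal.toReal_nonneg
      have hψv : (1 - x) * v ≤ ψ x := le_add_of_nonneg_right (by positivity)
      have e1 : c x ^ 2 / (1 - x ^ 2) * v = ((1 - x) * v) / ((1 + x) * ψ x ^ 2) := by
        have : 1 - x ^ 2 = (1 - x) * (1 + x) := by ring
        have hx0 := hx.1
        rw [hcdef, this]; field_simp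
      have hx0 := hx.1
      rw [e1, div_le_div_iff₀ (by positivity) h2]
      have h3 : ψ x * ψ x ≤ (1 + x) * ψ x ^ 2 := by nlinarith [sq_nonneg (ψ x)]
      nlinarith
  have hfin : radialSize μ e ρ < ⊤ := by
    have h := ENNReal.ofReal_lt_top (r := kernelSize μ z)
    rw [ofReal_kernelSize hz hz0] at h
    exact lt_of_le_of_lt le_add_self h
  refine ⟨szegoSum c e ρ, memDirichlet_of_dirichletNormSq_lt_top hdiff
    (hnorm.trans_lt (ENNReal.mul_lt_top (by simp) hfin)), hnorm, ?_⟩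
  have hval : szegoSum c e ρ z = ((∫ x in Ioo 0 ρ, c x / (1 - x * ρ) : ℝ) : ℂ) := by
    rw [szegoSum, ← integral_complex_ofReal]
    congr 1; ext x
    have hez : conj e * z = (ρ : ℂ) := by
      have hρ0 : (ρ : ℂ) ≠ 0 := by exact_mod_cast norm_ne_zero_iff.2 hz0
      rw [hedef, map_div₀, Complex.conj_ofReal, div_mul_eq_mul_div,
        ← Complex.normSq_eq_conj_mul_self, Complex.normSq_eq_norm_sq]
      push_cast
      rw [← hρdef]; field_simp
    rw [mul_assoc, hez]
    push_cast
    ring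
  have hnn : ∀ x ∈ Ioo 0 ρ, 0 ≤ c x / (1 - x * ρ) := fun x hx => by
    have h1 : 0 < 1 - x := by linarith [hx.2]
    have h2 := hψpos x hx
    have h3 : 0 < 1 - x * ρ := by nlinarith [hx.1, hx.2]
    positivity
  have hnn' := (ae_restrict_iff' (μ := volume) measurableSet_Ioo).2 (Filter.Eventually.of_forall hnn)
  have hint : IntegrableOn (fun x => c x / (1 - x * ρ)) (Ioo 0 ρ) := by
    have : IsFiniteMeasure (volume.restrict (Ioo 0 ρ)) := ⟨by simp⟩
    refine Integrable.of_bound (C := 1 / (1 - ρ) * (1 / (1 - ρ)))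
      (by fun_prop : Measurable fun x => c x / (1 - x * ρ)).aestronglyMeasurable
      (ae_mem_Ioo.mono fun x hx => ?_)
    have h3 : 0 < 1 - ρ := by linarith
    have h4 : 1 - ρ ≤ 1 - x * ρ := by nlinarith [hx.1, hx.2]
    have h5 : 0 < 1 - x * ρ := by linarith
    rw [norm_div, ← mul_one_div, Real.norm_eq_abs, Real.norm_of_nonneg h5.le]
    gcongr
    exact hM x hx
  rw [hval, ← ofReal_norm, Complex.norm_real, Real.norm_of_nonneg (integral_nonneg_of_ae hnn'),
    ofReal_integral_eq_lintegral_ofReal hint hnn', radialSize,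
    ← lintegral_const_mul' _ _ (by simp)]
  refine setLIntegral_mono' measurableSet_Ioo fun x hx => ?_
  rw [← ENNReal.ofReal_ofNat, ← ENNReal.ofReal_mul zero_le_two]
  refine ENNReal.ofReal_le_ofReal ?_
  have h1 : 0 < 1 - x := by linarith [hx.2]
  have h2 := hψpos x hx
  have h3 : 0 < 1 - x * ρ := by nlinarith [hx.1, hx.2]
  have e1 : 2 * (c x / (1 - x * ρ)) = 2 * (1 - x) / (1 - x * ρ) * (1 / ψ x) := by
    rw [hcdef]; field_simp
  rw [e1]
  refine le_mul_of_one_le_left (by positivity) ?_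
  -- For x < ρ, 1 - xρ ≤ 1 - x² ≤ 2(1-x); this is the origin of the factor 2.
  rw [one_le_div h3]
  nlinarith [hx.1, hx.2]

end Weight

/-! ### Hilbert space model of D_ω and existence of the kernel. -/

/-- The space of square summable Taylor coefficients. -/
abbrev CoeffSpace : Type := lp (fun _ : ℕ => ℂ) 2

/-- The space of square integrable functions for the measure `ω dA`. -/
abbrev WeightedSpace (ω : ℂ → ℝ≥0∞) : Type := Lp ℂ 2 (areaMeasure.withDensity ω)

/-- The Hilbert space in which `D_ω` is embedded by `f ↦ (coefficients of f, f')`. -/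
abbrev AmbientSpace (ω : ℂ → ℝ≥0∞) : Type := WithLp 2 (CoeffSpace × WeightedSpace ω)

theorem memℓp_two_iff {a : ℕ → ℂ} :
    Memℓp a 2 ↔ Summable fun n => ‖a n‖ ^ 2 := by
  rw [memℓp_gen_iff (by simp)]
  simp

theorem MemHardy.memℓp {f : ℂ → ℂ} (hf : MemHardy f) : Memℓp (taylorCoeff f) 2 :=
  memℓp_two_iff.2 hf.2

/-- The Taylor coefficients of a function of the Hardy space. -/
noncomputable def MemHardy.coeffVec {f : ℂ → ℂ} (hf : MemHardy f) : CoeffSpace :=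
  ⟨taylorCoeff f, hf.memℓp⟩

theorem MemHardy.coeffVec_apply {f : ℂ → ℂ} (hf : MemHardy f) (n : ℕ) :
    hf.coeffVec n = taylorCoeff f n := rfl

theorem memℓp_pow {z : ℂ} (hz : z ∈ disc) : Memℓp (fun n : ℕ => conj (z ^ n)) 2 := by
  rw [memℓp_two_iff]
  simp only [RCLike.norm_conj, norm_pow, ← pow_mul, mul_comm _ 2]
  simp only [pow_mul]
  exact summable_geometric_of_lt_one (by positivity) (by linarith [one_sub_normSq_pos hz])

theorem memℓp_nat_mul_pow {z : ℂ} (hz : z ∈ disc) :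
    Memℓp (fun n : ℕ => conj ((n : ℂ) * z ^ (n - 1))) 2 := by
  rw [memℓp_two_iff]
  refine (summable_nat_add_iff 1).1 ?_
  simp only [RCLike.norm_conj, add_tsub_cancel_right]
  have h : Summable fun n : ℕ => ‖((n : ℂ) + 1) * z ^ n‖ :=
    (hasSum_succ_mul_geometric (mem_disc.1 hz)).summable.norm
  have h2 := h.mul_norm h
  simpa [sq, Function.comp_def] using (h2.comp_injective (i := fun n : ℕ => (n, n))
    (fun x y h => by simpa using h))

open Classical in
/-- The vector representing evaluation at `z`. -/
noncomputable def evalVec (z : ℂ) : CoeffSpace :=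
  if hz : z ∈ disc then ⟨fun n => conj (z ^ n), memℓp_pow hz⟩ else 0

open Classical in
/-- The vector representing evaluation of the derivative at `z`. -/
noncomputable def derivVec (z : ℂ) : CoeffSpace :=
  if hz : z ∈ disc then ⟨fun n => conj ((n : ℂ) * z ^ (n - 1)), memℓp_nat_mul_pow hz⟩ else 0

theorem hasSum_inner_evalVec {z : ℂ} (hz : z ∈ disc) (a : CoeffSpace) :
    HasSum (fun n => a n * z ^ n) (inner ℂ (evalVec z) a) := by
  have h := lp.hasSum_inner (𝕜 := ℂ) (evalVec z) a
  refine h.congr_fun fun n => ?_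
  simp [evalVec, hz]

theorem hasSum_inner_derivVec {z : ℂ} (hz : z ∈ disc) (a : CoeffSpace) :
    HasSum (fun n : ℕ => (n + 1) * a (n + 1) * z ^ n) (inner ℂ (derivVec z) a) := by
  have h := lp.hasSum_inner (𝕜 := ℂ) (derivVec z) a
  -- At index 0 the truncated exponent 0 - 1 is harmless, because the coefficient n vanishes there.
  have h0 : ∑ i ∈ Finset.range 1, inner ℂ (derivVec z i) (a i) = 0 := by simp [derivVec, hz]
  rw [← hasSum_nat_add_iff' 1, h0, sub_zero] at h
  refine h.congr_fun fun n => ?_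
  simp [derivVec, hz]
  ring

/-- The holomorphic function with given Taylor coefficients. -/
noncomputable def powerSeriesFun (a : CoeffSpace) (z : ℂ) : ℂ := inner ℂ (evalVec z) a

theorem hasSum_powerSeriesFun (a : CoeffSpace) :
    ∀ z ∈ disc, HasSum (fun n => a n * z ^ n) (powerSeriesFun a z) :=
  fun _ hz => hasSum_inner_evalVec hz a

theorem deriv_powerSeriesFun (a : CoeffSpace) {z : ℂ} (hz : z ∈ disc) :
    deriv (powerSeriesFun a) z = inner ℂ (derivVec z) a :=
  (deriv_eq_tsum_of_hasSum (hasSum_powerSeriesFun a) hz).unique (hasSum_inner_derivVec hz a)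

theorem memHardy_powerSeriesFun (a : CoeffSpace) : MemHardy (powerSeriesFun a) :=
  ⟨differentiableOn_of_hasSum (hasSum_powerSeriesFun a), by
    simp only [taylorCoeff_eq_of_hasSum (hasSum_powerSeriesFun a)]
    exact memℓp_two_iff.1 (lp.memℓp a)⟩

section Embedding

variable {ω : ℂ → ℝ≥0∞}

theorem lintegral_weighted_eq_dirichletIntegral (hω : AEMeasurable ω areaMeasure) {f : ℂ → ℂ}
    (hf : DifferentiableOn ℂ f disc) :
    ∫⁻ z, ‖deriv f z‖ₑ ^ 2 ∂areaMeasure.withDensity ω = dirichletIntegral ω f := by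
  rw [lintegral_withDensity_eq_lintegral_mul₀ hω ((aestronglyMeasurable_areaMeasure
    (differentiableOn_deriv hf).continuousOn).enorm.pow_const 2), dirichletIntegral]
  congr 1; ext z
  simp only [Pi.mul_apply]; ring

theorem aestronglyMeasurable_deriv_weighted {f : ℂ → ℂ} (hf : DifferentiableOn ℂ f disc) :
    AEStronglyMeasurable (deriv f) (areaMeasure.withDensity ω) :=
  (aestronglyMeasurable_areaMeasure (differentiableOn_deriv hf).continuousOn).mono_ac
    (withDensity_absolutelyContinuous _ _)

theorem memLp_deriv_iff (hω : AEMeasurable ω areaMeasure) {f : ℂ → ℂ}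
    (hf : DifferentiableOn ℂ f disc) :
    MemLp (deriv f) 2 (areaMeasure.withDensity ω) ↔ dirichletIntegral ω f < ⊤ := by
  rw [← lintegral_weighted_eq_dirichletIntegral hω hf, MemLp,
    eLpNorm_lt_top_iff_lintegral_rpow_enorm_lt_top (by simp) (by simp)]
  simp [aestronglyMeasurable_deriv_weighted hf]

/-- The isometric embedding of `D_ω`. -/
noncomputable def embed (hω : AEMeasurable ω areaMeasure) {f : ℂ → ℂ} (hf : MemDirichlet ω f) :
    AmbientSpace ω :=
  WithLp.toLp 2 (hf.1.coeffVec, ((memLp_deriv_iff hω hf.1.1).2 hf.2).toLp)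

theorem inner_embed (hω : AEMeasurable ω areaMeasure) (hfin : ∀ᵐ z ∂areaMeasure, ω z < ⊤)
    {f g : ℂ → ℂ} (hf : MemDirichlet ω f) (hg : MemDirichlet ω g) :
    inner ℂ (embed hω hg) (embed hω hf) = dirichletInner ω f g := by
  rw [WithLp.prod_inner_apply, dirichletInner, hardyInner]
  refine congrArg₂ (· + ·) ?_ ?_
  · rw [lp.inner_eq_tsum]
    rfl
  · change inner ℂ ((memLp_deriv_iff hω hg.1.1).2 hg.2).toLp
      ((memLp_deriv_iff hω hf.1.1).2 hf.2).toLp = _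
    rw [L2.inner_def]
    have h1 : ∫ z, deriv f z * conj (deriv g z) ∂areaMeasure.withDensity ω =
        ∫ z, deriv f z * conj (deriv g z) * ((ω z).toReal : ℂ) ∂areaMeasure := by
      rw [integral_withDensity_eq_integral_toReal_smul₀ hω hfin]
      congr 1; ext z
      rw [Complex.real_smul, mul_comm]
    rw [← h1]
    refine integral_congr_ae ?_
    filter_upwards [((memLp_deriv_iff hω hf.1.1).2 hf.2).coeFn_toLp,
      ((memLp_deriv_iff hω hg.1.1).2 hg.2).coeFn_toLp] with z hz1 hz2
    rw [hz1, hz2]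
    simp

theorem ofReal_norm_sq_embed (hω : AEMeasurable ω areaMeasure) {f : ℂ → ℂ}
    (hf : MemDirichlet ω f) :
    ENNReal.ofReal (‖embed hω hf‖ ^ 2) = dirichletNormSq ω f := by
  rw [WithLp.prod_norm_sq_eq_of_L2, ENNReal.ofReal_add (by positivity) (by positivity),
    dirichletNormSq]
  congr 1
  · change ENNReal.ofReal (‖hf.1.coeffVec‖ ^ 2) = _
    have h := lp.norm_rpow_eq_tsum (p := 2) (by simp) hf.1.coeffVec
    simp only [ENNReal.toReal_ofNat, Real.rpow_two, MemHardy.coeffVec_apply] at h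
    have hs : Summable fun n => ‖taylorCoeff f n‖ ^ 2 := hf.1.2
    rw [h, ENNReal.ofReal_tsum_of_nonneg (fun n => by positivity) hs]
    congr 1; ext n
    rw [ENNReal.ofReal_pow (norm_nonneg _), ofReal_norm]
  · rw [← lintegral_weighted_eq_dirichletIntegral hω hf.1.1, ENNReal.ofReal_pow (norm_nonneg _),
      ofReal_norm]
    change ‖((memLp_deriv_iff hω hf.1.1).2 hf.2).toLp‖ₑ ^ 2 = _
    rw [Lp.enorm_toLp, eLpNorm_eq_lintegral_rpow_enorm_toReal (by simp) (by simp), ← ENNReal.rpow_two,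
      ← ENNReal.rpow_mul]
    simp

/-- The image of `D_ω` in the ambient Hilbert space. -/
noncomputable def dirichletSubmodule (ω : ℂ → ℝ≥0∞) : Submodule ℂ (AmbientSpace ω) where
  carrier := {p | ∀ᵐ z ∂areaMeasure.withDensity ω, p.ofLp.2 z = inner ℂ (derivVec z) p.ofLp.1}
  add_mem' := by
    intro p q hp hq
    filter_upwards [hp, hq, Lp.coeFn_add p.ofLp.2 q.ofLp.2] with z h1 h2 h3
    simp only [WithLp.ofLp_add, Prod.snd_add, Prod.fst_add]
    rw [h3, Pi.add_apply, h1, h2, inner_add_right]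
  zero_mem' := by
    filter_upwards [Lp.coeFn_zero ℂ 2 (areaMeasure.withDensity ω)] with z h1
    simp only [WithLp.ofLp_zero, Prod.snd_zero, Prod.fst_zero]
    rw [h1, Pi.zero_apply, inner_zero_right]
  smul_mem' := by
    intro c p hp
    filter_upwards [hp, Lp.coeFn_smul c p.ofLp.2] with z h1 h2
    simp only [WithLp.ofLp_smul, Prod.smul_snd, Prod.smul_fst]
    rw [h2, Pi.smul_apply, h1, inner_smul_right, smul_eq_mul]

/-- An L²-convergent sequence of second components has a subsequence converging almost everywhere.
Pairing with `derivVec z` is continuous on coefficients, so the constraint passes to the limit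
pointwise. -/
theorem isClosed_dirichletSubmodule (ω : ℂ → ℝ≥0∞) :
    IsClosed (dirichletSubmodule ω : Set (AmbientSpace ω)) := by
  refine IsSeqClosed.isClosed fun p q hp hpq => ?_
  have hc := (WithLp.prod_continuous_ofLp 2 CoeffSpace (WeightedSpace ω)).tendsto q
  have h1 : Filter.Tendsto (fun k => (p k).ofLp.1) Filter.atTop (nhds q.ofLp.1) :=
    (continuous_fst.tendsto _).comp (hc.comp hpq)
  have h2 : Filter.Tendsto (fun k => (p k).ofLp.2) Filter.atTop (nhds q.ofLp.2) :=
    (continuous_snd.tendsto _).comp (hc.comp hpq)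
  obtain ⟨ns, hns, hae⟩ := (tendstoInMeasure_of_tendsto_Lp h2).exists_seq_tendsto_ae
  have hall : ∀ᵐ z ∂areaMeasure.withDensity ω, ∀ k,
      (p k).ofLp.2 z = inner ℂ (derivVec z) (p k).ofLp.1 := ae_all_iff.2 hp
  change ∀ᵐ z ∂areaMeasure.withDensity ω, q.ofLp.2 z = inner ℂ (derivVec z) q.ofLp.1
  filter_upwards [hae, hall] with z hz1 hz2
  refine tendsto_nhds_unique hz1 ?_
  simp only [hz2]
  have h3 : Continuous fun a : CoeffSpace => inner ℂ (derivVec z) a := by fun_prop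
  exact ((h3.tendsto _).comp h1).comp hns.tendsto_atTop

theorem ae_weighted_mem_disc (ω : ℂ → ℝ≥0∞) : ∀ᵐ z ∂areaMeasure.withDensity ω, z ∈ disc :=
  (withDensity_absolutelyContinuous _ _).ae_le ae_mem_disc

theorem embed_mem (hω : AEMeasurable ω areaMeasure) {f : ℂ → ℂ} (hf : MemDirichlet ω f) :
    embed hω hf ∈ dirichletSubmodule ω := by
  change ∀ᵐ z ∂areaMeasure.withDensity ω, (embed hω hf).ofLp.2 z = _
  filter_upwards [ae_weighted_mem_disc ω,
    ((memLp_deriv_iff hω hf.1.1).2 hf.2).coeFn_toLp] with z hz h1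
  have h2 := hasSum_inner_derivVec hz (embed hω hf).ofLp.1
  have h3 : HasSum (fun n : ℕ => (n + 1) * (embed hω hf).ofLp.1 (n + 1) * z ^ n) (deriv f z) :=
    hasSum_deriv hf.1.1 hz
  rw [h2.unique h3]
  exact h1

/-- Together with `embed_mem` this shows that the closed submodule is exactly the image of D_ω, so
projections onto it are genuine functions of the space. -/
theorem exists_embed_eq (hω : AEMeasurable ω areaMeasure) {p : AmbientSpace ω}
    (hp : p ∈ dirichletSubmodule ω) :
    ∃ h : MemDirichlet ω (powerSeriesFun p.ofLp.1), embed hω h = p := by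
  have hH := memHardy_powerSeriesFun p.ofLp.1
  have hae : p.ofLp.2 =ᵐ[areaMeasure.withDensity ω] deriv (powerSeriesFun p.ofLp.1) := by
    have hp' : ∀ᵐ z ∂areaMeasure.withDensity ω,
      p.ofLp.2 z = inner ℂ (derivVec z) p.ofLp.1 := hp
    filter_upwards [hp', ae_weighted_mem_disc ω] with z h1 hz
    rw [h1, deriv_powerSeriesFun _ hz]
  have hm : MemLp (deriv (powerSeriesFun p.ofLp.1)) 2 (areaMeasure.withDensity ω) :=
    (memLp_congr_ae hae).1 (Lp.memLp p.ofLp.2)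
  refine ⟨⟨hH, (memLp_deriv_iff hω hH.1).1 hm⟩, ?_⟩
  have e1 : hH.coeffVec = p.ofLp.1 := by
    ext n
    exact taylorCoeff_eq_of_hasSum (hasSum_powerSeriesFun p.ofLp.1) n
  have e2 : hm.toLp = p.ofLp.2 := by
    refine Lp.ext ?_
    exact hm.coeFn_toLp.trans hae.symm
  change WithLp.toLp 2 (hH.coeffVec, hm.toLp) = p
  rw [e1, e2]

/-- Existence of the reproducing kernel. -/
theorem exists_isReproducingKernel (hω : AEMeasurable ω areaMeasure)
    (hfin : ∀ᵐ z ∂areaMeasure, ω z < ⊤) : ∃ K : ℂ → ℂ → ℂ, IsReproducingKernel ω K := by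
  have : CompleteSpace (dirichletSubmodule ω) :=
    (isClosed_dirichletSubmodule ω).completeSpace_coe
  -- Pairing with this vector sends an embedded f to ∑ a_n zⁿ = f(z). Its projection has the same
  -- pairings and belongs to the image of D_ω.
  set k : ℂ → AmbientSpace ω := fun z => WithLp.toLp 2 (evalVec z, 0) with hk
  set P : ℂ → AmbientSpace ω := fun z => (dirichletSubmodule ω).starProjection (k z) with hP
  refine ⟨fun ζ z => powerSeriesFun (P z).ofLp.1 ζ, fun z hz => ?_⟩
  obtain ⟨h, he⟩ := exists_embed_eq hω ((dirichletSubmodule ω).starProjection_apply_mem (k z))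
  refine ⟨h, fun f hf => ?_⟩
  have h1 := Submodule.starProjection_inner_eq_zero (K := dirichletSubmodule ω) (k z) _
    (embed_mem hω hf)
  rw [inner_sub_left, sub_eq_zero] at h1
  rw [← inner_embed hω hfin hf h, he, ← h1, WithLp.prod_inner_apply]
  simp only [hk, inner_zero_left, add_zero]
  exact (hasSum_taylorCoeff hf.1.1 hz).unique (hasSum_inner_evalVec hz (embed hω hf).ofLp.1)

end Embedding

/-! ### Two-sided estimate of the kernel on the diagonal. -/

theorem hasSum_const_one (z : ℂ) :
    HasSum (fun n : ℕ => (Pi.single 0 1 : ℕ → ℂ) n * z ^ n) ((fun _ => (1 : ℂ)) z) := by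
  have h := hasSum_single (f := fun n : ℕ => (Pi.single 0 1 : ℕ → ℂ) n * z ^ n) 0
    (fun n hn => by simp [hn])
  simpa using h

theorem dirichletNormSq_const_one (ω : ℂ → ℝ≥0∞) :
    dirichletNormSq ω (fun _ => 1) = 1 := by
  rw [dirichletNormSq, dirichletIntegral]
  simp only [taylorCoeff_eq_of_hasSum fun z _ => hasSum_const_one z, deriv_const]
  rw [tsum_eq_single 0 (fun n hn => by simp [hn])]
  simp

theorem memDirichlet_const_one (ω : ℂ → ℝ≥0∞) : MemDirichlet ω (fun _ => 1) :=
  memDirichlet_of_dirichletNormSq_lt_top (differentiableOn_const _)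
    (by rw [dirichletNormSq_const_one]; exact ENNReal.one_lt_top)

section Kernel

variable {ω : ℂ → ℝ≥0∞} {μ : Measure ℂ} {K : ℂ → ℂ → ℂ} {z : ℂ}

theorem kernel_diag_eq (hω : IsPureSuperharmonicWeight ω μ) (hK : IsReproducingKernel ω K)
    (hz : z ∈ disc) :
    K z z = ((‖embed (aemeasurable_weight hω) (hK z hz).1‖ ^ 2 : ℝ) : ℂ) := by
  rw [(hK z hz).2 _ (hK z hz).1,
    ← inner_embed (aemeasurable_weight hω) (weight_lt_top hω) (hK z hz).1 (hK z hz).1,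
    inner_self_eq_norm_sq_to_K]
  simp

theorem ofReal_kernel_diag (hω : IsPureSuperharmonicWeight ω μ) (hK : IsReproducingKernel ω K)
    (hz : z ∈ disc) : ENNReal.ofReal (K z z).re = dirichletNormSq ω (fun ζ => K ζ z) := by
  rw [kernel_diag_eq hω hK hz, Complex.ofReal_re, ofReal_norm_sq_embed]

theorem enorm_sq_le_kernel_diag_mul (hω : IsPureSuperharmonicWeight ω μ)
    (hK : IsReproducingKernel ω K) (hz : z ∈ disc) {f : ℂ → ℂ} (hf : MemDirichlet ω f) :
    ‖f z‖ₑ ^ 2 ≤ ENNReal.ofReal (K z z).re * dirichletNormSq ω f := by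
  have hm := aemeasurable_weight hω
  rw [ofReal_kernel_diag hω hK hz, (hK z hz).2 f hf,
    ← inner_embed hm (weight_lt_top hω) hf (hK z hz).1, ← ofReal_norm_sq_embed hm (hK z hz).1,
    ← ofReal_norm_sq_embed hm hf, ← ofReal_norm, ← ENNReal.ofReal_pow (norm_nonneg _),
    ← ENNReal.ofReal_mul (by positivity), ← mul_pow]
  exact ENNReal.ofReal_le_ofReal
    (pow_le_pow_left₀ (norm_nonneg _) (norm_inner_le_norm _ _) 2)

/-- Apply the pointwise estimate to f = K(·,z). With N = K(z,z), both f(z) and ‖f‖² equal N, so N² ≤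
288 · size · N. -/
theorem kernel_diag_le (hω : IsPureSuperharmonicWeight ω μ) (hK : IsReproducingKernel ω K)
    (hz : z ∈ disc) (hz0 : z ≠ 0) : (K z z).re ≤ 288 * kernelSize μ z := by
  have hsize : 0 < kernelSize μ z := by
    have := sFinite_restrict_disc hω.riesz_finite
    rw [← ENNReal.ofReal_pos, ofReal_kernelSize hz hz0]
    simp
  set N : ℝ := ‖embed (aemeasurable_weight hω) (hK z hz).1‖ ^ 2 with hN
  have hdiag : K z z = (N : ℂ) := kernel_diag_eq hω hK hz
  have hN0 : 0 ≤ N := by positivity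
  have h := enorm_sq_le_kernelSize_mul hω (hK z hz).1.1.1 hz hz0
  rw [← ofReal_kernel_diag hω hK hz, hdiag, Complex.ofReal_re, enorm_ofReal_sq,
    ← ENNReal.ofReal_ofNat, ← ENNReal.ofReal_mul (by norm_num),
    ← ENNReal.ofReal_mul (by positivity), ENNReal.ofReal_le_ofReal_iff (by positivity)] at h
  rw [hdiag, Complex.ofReal_re]
  by_contra hlt
  push Not at hlt
  nlinarith

/-- The constant 1 gives K(z,z) ≥ 1 and the test function gives S² ≤ 4 · 24 · K(z,z) · S; the two
add up to 97. -/
theorem kernelSize_le (hω : IsPureSuperharmonicWeight ω μ) (hK : IsReproducingKernel ω K)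
    (hz : z ∈ disc) (hz0 : z ≠ 0) : kernelSize μ z ≤ 97 * (K z z).re := by
  have := sFinite_restrict_disc hω.riesz_finite
  set N := ENNReal.ofReal (K z z).re with hN
  set S := radialSize μ (z / (‖z‖ : ℂ)) ‖z‖ with hS
  have hsize := ofReal_kernelSize (μ := μ) hz hz0
  have h1 : 1 ≤ N := by
    have := enorm_sq_le_kernel_diag_mul hω hK hz (memDirichlet_const_one ω)
    rw [dirichletNormSq_const_one, mul_one] at this
    simpa only [enorm_one, one_pow] using this
  have h2 : S ≤ 96 * N := by
    obtain ⟨f, hf, hn, hv⟩ := exists_memDirichlet_radialSize_le hω hz hz0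
    have h3 := enorm_sq_le_kernel_diag_mul hω hK hz hf
    have h4 : S * S ≤ 96 * N * S :=
      calc S * S ≤ (2 * ‖f z‖ₑ) * (2 * ‖f z‖ₑ) := mul_le_mul' hv hv
        _ = 4 * ‖f z‖ₑ ^ 2 := by ring
        _ ≤ 4 * (N * (24 * S)) := by gcongr; exact h3.trans (by gcongr)
        _ = 96 * N * S := by ring
    have hfin : S ≠ ⊤ := by
      refine ne_top_of_le_ne_top (ENNReal.ofReal_ne_top (r := kernelSize μ z)) ?_
      rw [hsize]; exact le_add_self
    -- Cancelling S in [0, ∞] needs it finite and nonzero; the bound is trivial when S = 0.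
    rcases eq_or_ne S 0 with h0 | h0
    · rw [h0]; exact zero_le
    · exact (ENNReal.mul_le_mul_iff_left h0 hfin).1 h4
  have hre : 0 ≤ (K z z).re := by
    rw [kernel_diag_eq hω hK hz, Complex.ofReal_re]; positivity
  rw [← ENNReal.ofReal_le_ofReal_iff (by positivity), hsize, ENNReal.ofReal_mul (by norm_num),
    ENNReal.ofReal_ofNat, ← hN]
  calc 1 + S ≤ N + 96 * N := add_le_add h1 h2
    _ = 97 * N := by ring

end Kernel

end SuperharmonicDirichlet

theorem theorem3p1 :
    ∃ c C : ℝ, 0 < c ∧ 0 < C ∧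
      ∀ (ω : ℂ → ENNReal) (μ : MeasureTheory.Measure ℂ),
        SuperharmonicDirichlet.IsPureSuperharmonicWeight ω μ →
        (∃ K : ℂ → ℂ → ℂ, SuperharmonicDirichlet.IsReproducingKernel ω K) ∧
        ∀ K : ℂ → ℂ → ℂ, SuperharmonicDirichlet.IsReproducingKernel ω K →
          ∀ z ∈ SuperharmonicDirichlet.disc, z ≠ 0 →
            (K z z).im = 0 ∧
            c * SuperharmonicDirichlet.kernelSize μ z ≤ (K z z).re ∧
            (K z z).re ≤ C * SuperharmonicDirichlet.kernelSize μ z := by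
  refine ⟨1 / 97, 288, by norm_num, by norm_num, fun ω μ hω =>
    ⟨SuperharmonicDirichlet.exists_isReproducingKernel
      (SuperharmonicDirichlet.aemeasurable_weight hω) (SuperharmonicDirichlet.weight_lt_top hω),
      fun K hK z hz hz0 => ⟨?_, ?_, SuperharmonicDirichlet.kernel_diag_le hω hK hz hz0⟩⟩⟩
  · rw [SuperharmonicDirichlet.kernel_diag_eq hω hK hz, Complex.ofReal_im]
  · have := SuperharmonicDirichlet.kernelSize_le hω hK hz hz0
    linarith
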